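/- **Setting.** A locally checkable labeling (LCL) problem $\Psi$ on graphs of maximal degree at most a constant $\Delta$ consists of finite sets of input and output labels for nodes and half-edges, a radius $t$, and a finite set $\mathcal C$ of rooted labeled graphs; given an input labeling $x$ of a graph $G$, an output labeling is *valid* if for every node $v$ the labeled subgraph induced by the $t$-neighborhood of $v$, rooted at $v$, is isomorphic to an element of $\mathcal C$. A LOCAL algorithm $\mathcal A$ is a Turing machine run by every node of an $n$-vertex network in synchronous rounds of message passing. Each node knows $n$, has a unique identifier smaller than $n^{c}$ (for a constant $c\ge 1$), its own input labels, its private random bits and a common public random string $r_{\rm pub}$, and runs in time polynomial in $n$ (so the numbers of public and private random bits are polynomial as well). In the preset public coins model the network is fixed, then $r_{\rm pub}$ is drawn uniformly, then an adversary, who may depend on $\mathcal A$ and on the network, sees $r_{\rm pub}$ and chooses the input labeling $x$, and then the private coins $r_{\rm sec}$ of the nodes are drawn. Let $\varepsilon:\mathbb N\to\mathbb R$ and $r:\mathbb N\to\mathbb N$. * $\mathsf{ROUND}^{\mathsf B}_{\varepsilon(n)}(\Psi)\le r(n)$ means that there is a LOCAL algorithm $\mathcal A$ such that, for every family of (non-uniform)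 randomized polynomial-time adversaries, for all sufficiently large $n$ and all $n$-vertex networks, $\mathcal A$ outputs a valid labeling within $r(n)$ rounds with probability at least $1-\varepsilon(n)$ over $r_{\rm pub}$, $r_{\rm sec}$ and the adversary's coins. * $\mathsf{ROUND}^{\mathsf U}_{\varepsilon(n)}(\Psi)\le r(n)$ means that there is a LOCAL algorithm $\mathcal A$ such that, for all sufficiently large $n$, all $n$-vertex networks and all functions (computationally unbounded adversaries) from public strings to input labelings, $\mathcal A$ outputs a valid labeling within $r(n)$ rounds with probability at least $1-\varepsilon(n)$ over $r_{\rm pub}$ and $r_{\rm sec}$. **Theorem.** Let $\Psi$ be an LCL problem. Assume that there are a negligible function $\mathsf{negl}(n)$ and a polynomial $p(n)$ (positive for all large $n$) such that $$\mathsf{ROUND}^{\mathsf B}_{\mathsf{negl}(n)}(\Psi)<\mathsf{ROUND}^{\mathsf U}_{1/p(n)}(\Psi),$$ that is, for some function $r$ we have $\mathsf{ROUND}^{\mathsf B}_{\mathsf{negl}(n)}(\Psi)\le r(n)$ but not $\mathsf{ROUND}^{\mathsf U}_{1/p(n)}(\Psi)\le r(n)$. Then there is a public-coin infinitely-often polynomially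 hard-on-average problem in $\mathsf{TFNP}/\mathsf{poly}$. Explicitly, there are a relation $\mathcal S\subseteq\{0,1\}^*\times\{0,1\}^*$ and a length-preserving polynomial-time computable sampler $D:\{0,1\}^*\to\{0,1\}^*$ such that 1. there is a polynomial bound on $|w|$ in terms of $|x|$ for all $(x,w)\in\mathcal S$; membership in $\mathcal S$ is decided by Boolean circuits of polynomial size; and every $x$ has some $w$ with $(x,w)\in\mathcal S$; 2. for every polynomial $T$ there is a negligible function $\mu$ such that for every family of randomized (non-uniform) solvers $(\mathcal B_\lambda)_\lambda$ of size at most $T(\lambda)$, for infinitely many $\lambda$, $$\Pr_{r\in\{0,1\}^\lambda,\ \text{coins of }\mathcal B_\lambda}\bigl[\,\mathcal S_{x}\ne\emptyset\Rightarrow(x,\mathcal B_\lambda(x,r))\in\mathcal S\ \text{ for } x=D(r)\,\bigr]<\mu(\lambda).$$ -/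

import Mathlib

open Filter Computability

/-! ## Asymptotics and finite probability -/

/-- `ε` is negligible: it tends to `0` faster than the inverse of every polynomial. -/
def Negligible (ε : ℕ → ℝ) : Prop :=
  Asymptotics.SuperpolynomialDecay atTop (fun n : ℕ => (n : ℝ)) ε

open Classical in
/-- The probability of the event `E` under the uniform distribution on a finite sample space. -/
noncomputable def prob {Ω : Type} [Fintype Ω] (E : Ω → Prop) : ℝ :=
  ((Finset.univ.filter E).card : ℝ) / (Fintype.card Ω : ℝ)

/-! ## Boolean circuits (the non-uniform computations) -/

/-- A gate of a circuit; its arguments are indices of earlier wires. -/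
inductive Gate where
  | const (b : Bool)
  | not (i : ℕ)
  | and (i j : ℕ)
  | or (i j : ℕ)

/-- The value of a gate, given the values of the earlier wires
(a wire that does not exist carries `false`). -/
def Gate.eval (ws : List Bool) : Gate → Bool
  | .const b => b
  | .not i => !(ws.getD i false)
  | .and i j => ws.getD i false && ws.getD j false
  | .or i j => ws.getD i false || ws.getD j false

/-- The values of all wires of a straight-line program of gates: the wires are first the input
bits and then, in order, the gates. -/
def wires (gates : List Gate) (x : List Bool) : List Bool :=
  gates.foldl (fun ws g => ws ++ [g.eval ws]) x

/-- A Boolean circuit with several outputs, given by its gates and by the list of output wires. -/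
structure Circuit where
  gates : List Gate
  outs : List ℕ

/-- The size of a circuit. -/
def Circuit.size (C : Circuit) : ℕ := C.gates.length + C.outs.length

/-- The output of a circuit on the input `x`. -/
def Circuit.eval (C : Circuit) (x : List Bool) : List Bool :=
  C.outs.map fun i => (wires C.gates x).getD i false

/-- A randomized circuit: a circuit, some of whose input bits are uniform coins. -/
structure RandCircuit where
  coins : ℕ
  circuit : Circuit

/-- The size of a randomized circuit, its coins included. -/
def RandCircuit.size (C : RandCircuit) : ℕ := C.coins + C.circuit.size

/-- A circuit has a fixed number of output bits, while solutions of search problems may have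
varying lengths; the output `0 ⋯ 0 1 w` stands for the bit string `w`. -/
def unpad (o : List Bool) : List Bool := (o.dropWhile fun b => !b).tail

/-! ## Search problems and average-case hardness -/

/-- A search problem: a binary relation between bit strings (instances, solutions). -/
abbrev SearchProblem := List Bool → List Bool → Prop

/-- The class `TFNP/poly`: solutions are polynomially bounded, they can be verified by
polynomial-size Boolean circuits (one for each pair of lengths), and every instance has one. -/
structure SearchProblem.InTFNPpoly (S : SearchProblem) : Prop where
  bounded : ∃ p : Polynomial ℕ, ∀ x w, S x w → w.length ≤ p.eval x.length
  verifiable : ∃ q : Polynomial ℕ, ∀ a b : ℕ, ∃ C : Circuit, C.size ≤ q.eval (a + b) ∧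
    ∀ x w : List Bool, x.length = a → w.length = b → (C.eval (x ++ w) = [true] ↔ S x w)
  total : ∀ x, ∃ w, S x w

/-- A sampler: a length-preserving function on bit strings that a Turing machine computes in
polynomial time. On uniform coins `r` of length `l`, it samples the instance `D r`; thus it
determines an ensemble whose `l`-th distribution, on strings of length `l`, is the law
of `D r`. -/
structure IsSampler (D : List Bool → List Bool) : Prop where
  length_eq : ∀ r, (D r).length = r.length
  polytime : Nonempty (Turing.TM2ComputableInPolyTime
    (id : List Bool → List Bool) (id : List Bool → List Bool) D)

/-- The probability, over the coins `r` (of length `l`) of the sampler and over the coins of the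
solver, that the solver wins: if the instance `D r` has a solution, then the solver, which
sees the instance and also `r`, outputs one. -/
noncomputable def winProb (S : SearchProblem) (D : List Bool → List Bool) (l : ℕ)
    (Sol : RandCircuit) : ℝ :=
  prob fun ω : (Fin l → Bool) × (Fin Sol.coins → Bool) =>
    (∃ w, S (D (List.ofFn ω.1)) w) →
      S (D (List.ofFn ω.1))
        (unpad (Sol.circuit.eval (D (List.ofFn ω.1) ++ List.ofFn ω.1 ++ List.ofFn ω.2)))

/-- The distributional problem `(S, D)` is public-coin infinitely-often polynomially
hard-on-average (against non-uniform solvers): for every polynomial `T` there is a negligible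
`μ` such that each family of randomized solvers of size at most `T(l)` wins on length `l` with
probability less than `μ(l)`, for infinitely many `l`. -/
def PublicCoinInfOftenPolyHard (S : SearchProblem) (D : List Bool → List Bool) : Prop :=
  ∀ T : Polynomial ℕ, ∃ μ : ℕ → ℝ, Negligible μ ∧
    ∀ Sol : ℕ → RandCircuit, (∀ l, (Sol l).size ≤ T.eval l) →
      ∃ᶠ l in atTop, winProb S D l (Sol l) < μ l

/-! ## Labelings and locally checkable problems -/

/-- A labeling of the nodes of `G` by `a` labels and of its half-edges by `b` labels. The
half-edge `(v, {v, u})` is the dart from `v` to `u`. -/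
structure Labeling {n : ℕ} (G : SimpleGraph (Fin n)) (a b : ℕ) where
  node : Fin n → Fin a
  half : G.Dart → Fin b

/-- A finite graph with a root and with input and output labels. -/
structure RootedLabeledGraph (vIn eIn vOut eOut : ℕ) where
  size : ℕ
  graph : SimpleGraph (Fin size)
  root : Fin size
  input : Labeling graph vIn eIn
  output : Labeling graph vOut eOut

/-- The nodes that can be reached from `v` through paths of length at most `t`. -/
def ballAt {n : ℕ} (G : SimpleGraph (Fin n)) (v : Fin n) (t : ℕ) : Set (Fin n) :=
  {u | ∃ w : G.Walk v u, w.length ≤ t}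

/-- `H` is isomorphic, as a rooted labeled graph, to the subgraph of `G` (labeled by `x` and `y`)
that is induced by the `t`-neighborhood of `v`, with root `v`. -/
def RootedLabeledGraph.IsNeighborhood {vIn eIn vOut eOut n : ℕ}
    (H : RootedLabeledGraph vIn eIn vOut eOut) (G : SimpleGraph (Fin n))
    (x : Labeling G vIn eIn) (y : Labeling G vOut eOut) (v : Fin n) (t : ℕ) : Prop :=
  ∃ f : H.graph ↪g G, Set.range f = ballAt G v t ∧ f H.root = v ∧
    (∀ i, x.node (f i) = H.input.node i) ∧
    (∀ e, x.half (f.toHom.mapDart e) = H.input.half e) ∧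
    (∀ i, y.node (f i) = H.output.node i) ∧
    (∀ e, y.half (f.toHom.mapDart e) = H.output.half e)

/-- A locally checkable labeling problem, on graphs of maximal degree at most `maxDeg`: numbers
of input and output labels for nodes and half-edges, a radius and a finite set of allowed
labeled neighborhoods. -/
structure LCL where
  maxDeg : ℕ
  vIn : ℕ
  eIn : ℕ
  vOut : ℕ
  eOut : ℕ
  radius : ℕ
  allowed : Set (RootedLabeledGraph vIn eIn vOut eOut)
  allowed_finite : allowed.Finite
  allowed_radius : ∀ H ∈ allowed, ∀ u, u ∈ ballAt H.graph H.root radius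

/-- `y` is a solution on the graph `G` with input labeling `x`. -/
def LCL.IsSolution (Ψ : LCL) {n : ℕ} {G : SimpleGraph (Fin n)}
    (x : Labeling G Ψ.vIn Ψ.eIn) (y : Labeling G Ψ.vOut Ψ.eOut) : Prop :=
  ∀ v, ∃ H ∈ Ψ.allowed, H.IsNeighborhood G x y v Ψ.radius

/-! ## The LOCAL model with polynomial-time nodes -/

/-- A network: a graph on `n` nodes of maximal degree at most `Δ`, together with unique
identifiers of `O(log n)` bits (numbers below `n ^ c`) and, at every node, a numbering of the
ports by which it is connected to its neighbors. -/
structure Network (Δ c n : ℕ) where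
  graph : SimpleGraph (Fin n)
  ident : Fin n → ℕ
  ident_injective : Function.Injective ident
  ident_lt : ∀ v, ident v < n ^ c
  ports : Fin n → List (Fin n)
  ports_nodup : ∀ v, (ports v).Nodup
  mem_ports : ∀ v u, u ∈ ports v ↔ graph.Adj v u
  length_ports : ∀ v, (ports v).length ≤ Δ

/-- The port of `u` that leads to its neighbor `v`. -/
def Network.portTo {Δ c n : ℕ} (N : Network Δ c n) (u v : Fin n) (h : u ∈ N.ports v) : Fin Δ :=
  ⟨(N.ports u).idxOf v, lt_of_lt_of_le
    (List.idxOf_lt_length_of_mem ((N.mem_ports u v).2 ((N.mem_ports v u).1 h).symm))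
    (N.length_ports u)⟩

/-- The tapes of a node: its input, its private coins, the public coins, the communication tapes
(an inbox and an outbox for each port) and `k` work tapes. -/
inductive TapeIdx (Δ k : ℕ) where
  | input
  | priv
  | pub
  | inbox (i : Fin Δ)
  | outbox (i : Fin Δ)
  | work (j : Fin k)

/-- A movement of a head. -/
inductive Move where
  | left
  | stay
  | right

/-- The position of a head after a movement, on a tape with a left end. -/
def Move.apply : Move → ℕ → ℕ
  | .left, i => i - 1
  | .stay, i => i
  | .right, i => i + 1

/-- What a node does in a given state: a step of its multi-tape Turing machine (depending on the
scanned symbols: the next state and, for each tape, the symbol to write and a movement), or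
waiting for the messages of the next round (with the state in which to go on), or halting, with
an output (an output label for the node, and for its half-edges in the order of the ports). -/
inductive Instr (Q T : Type) (vOut eOut : ℕ) where
  | compute (δ : (T → Γ') → Q × (T → Γ' × Move))
  | wait (next : Q)
  | halt (node : Fin vOut) (half : List (Fin eOut))

/-- A (randomized, public-coin) LOCAL algorithm for `Ψ`, with polynomial-time nodes: a multi-tape
Turing machine, the same for all nodes, the numbers of public coins and of private coins
per node, and a polynomial in the graph size that bounds all resources. -/
structure LocalAlgorithm (Ψ : LCL) where
  numStates : ℕ
  numWork : ℕ
  start : Fin numStates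
  program : Fin numStates → Instr (Fin numStates) (TapeIdx Ψ.maxDeg numWork) Ψ.vOut Ψ.eOut
  pubLen : ℕ → ℕ
  privLen : ℕ → ℕ
  time : Polynomial ℕ
  pubLen_le : ∀ n, pubLen n ≤ time.eval n
  privLen_le : ∀ n, privLen n ≤ time.eval n

/-- A tape with the given content, after a left end marker. -/
def tapeOf (l : List Γ') (i : ℕ) : Γ' := (Γ'.bra :: l).getD i Γ'.blank

/-- The number `k` in unary. -/
def unarySym (k : ℕ) : List Γ' := List.replicate k (Γ'.bit true)

/-- The content of the input tape of the node `v`: the graph size in unary, the identifier of `v`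
in binary, the input label of `v` and those of its half-edges in the order of the ports (as
unary numbers, increased by one), separated by commas. -/
def inputSyms {Δ c n a b : ℕ} (N : Network Δ c n) (x : Labeling N.graph a b) (v : Fin n) :
    List Γ' :=
  unarySym n ++ [Γ'.comma] ++ (Nat.bits (N.ident v)).map Γ'.bit ++ [Γ'.comma] ++
    unarySym ((x.node v : ℕ) + 1) ++ [Γ'.comma] ++
    (N.ports v).attach.flatMap fun u =>
      unarySym ((x.half ⟨(v, u.1), (N.mem_ports v u.1).1 u.2⟩ : ℕ) + 1) ++ [Γ'.comma]

namespace LocalAlgorithm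

variable {Ψ : LCL}

/-- A configuration of a node. -/
structure Cfg (A : LocalAlgorithm Ψ) where
  state : Fin A.numStates
  head : TapeIdx Ψ.maxDeg A.numWork → ℕ
  cell : TapeIdx Ψ.maxDeg A.numWork → ℕ → Γ'

/-- The public coins on graphs with `n` nodes. -/
abbrev PubCoins (A : LocalAlgorithm Ψ) (n : ℕ) : Type := Fin (A.pubLen n) → Bool

/-- The private coins of all nodes on graphs with `n` nodes. -/
abbrev PrivCoins (A : LocalAlgorithm Ψ) (n : ℕ) : Type := Fin n → Fin (A.privLen n) → Bool

/-- One step of the Turing machine of a node; a waiting or halted node does nothing. -/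
def step (A : LocalAlgorithm Ψ) (s : A.Cfg) : A.Cfg :=
  match A.program s.state with
  | .compute δ =>
    let a := δ fun T => s.cell T (s.head T)
    { state := a.1
      head := fun T => (a.2 T).2.apply (s.head T)
      cell := fun T => Function.update (s.cell T) (s.head T) (a.2 T).1 }
  | .wait _ => s
  | .halt _ _ => s

/-- The local computation of a node in one round; its running time is bounded by the polynomial
of the algorithm. -/
noncomputable def localComputation (A : LocalAlgorithm Ψ) (n : ℕ) (s : A.Cfg) : A.Cfg :=
  A.step^[A.time.eval n] s

/-- The initial configuration of the node `v`. -/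
def initialCfg (A : LocalAlgorithm Ψ) {c n : ℕ} (N : Network Ψ.maxDeg c n)
    (x : Labeling N.graph Ψ.vIn Ψ.eIn) (ρ : A.PubCoins n) (σ : A.PrivCoins n) (v : Fin n) :
    A.Cfg where
  state := A.start
  head := fun _ => 0
  cell := fun T => match T with
    | .input => tapeOf (inputSyms N x v)
    | .priv => tapeOf ((List.ofFn (σ v)).map Γ'.bit)
    | .pub => tapeOf ((List.ofFn ρ).map Γ'.bit)
    | .inbox _ => tapeOf []
    | .outbox _ => tapeOf []
    | .work _ => tapeOf []

/-- The message that a node in configuration `s` sends through its port `i`: the content of its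
outbox if it is waiting for the next round, and nothing otherwise. -/
def message (A : LocalAlgorithm Ψ) (s : A.Cfg) (i : Fin Ψ.maxDeg) : ℕ → Γ' :=
  match A.program s.state with
  | .compute _ => tapeOf []
  | .wait _ => s.cell (.outbox i)
  | .halt _ _ => tapeOf []

/-- The message that arrives at port `i` of the node `v`. -/
def received (A : LocalAlgorithm Ψ) {c n : ℕ} (N : Network Ψ.maxDeg c n) (s : Fin n → A.Cfg)
    (v : Fin n) (i : ℕ) : ℕ → Γ' :=
  if h : i < (N.ports v).length then
    A.message (s ((N.ports v)[i])) (N.portTo ((N.ports v)[i]) v (List.getElem_mem h))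
  else tapeOf []

/-- The exchange of messages: the inboxes are filled, the outboxes are emptied, and the waiting
nodes go on. -/
def exchange (A : LocalAlgorithm Ψ) {c n : ℕ} (N : Network Ψ.maxDeg c n) (s : Fin n → A.Cfg)
    (v : Fin n) : A.Cfg where
  state := match A.program (s v).state with
    | .compute _ => (s v).state
    | .wait q => q
    | .halt _ _ => (s v).state
  head := fun T => match T with
    | .inbox _ => 0
    | .outbox _ => 0
    | T => (s v).head T
  cell := fun T => match T with
    | .inbox i => A.received N s v i
    | .outbox _ => tapeOf []
    | T => (s v).cell T

/-- The configurations of all nodes after `k` rounds of communication. -/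
noncomputable def run (A : LocalAlgorithm Ψ) {c n : ℕ} (N : Network Ψ.maxDeg c n)
    (x : Labeling N.graph Ψ.vIn Ψ.eIn) (ρ : A.PubCoins n) (σ : A.PrivCoins n) :
    ℕ → Fin n → A.Cfg
  | 0 => fun v => A.localComputation n (A.initialCfg N x ρ σ v)
  | k + 1 => fun v => A.localComputation n (A.exchange N (A.run N x ρ σ k) v)

/-- In the configurations `s`, all nodes have halted, with the output labeling `y`. -/
def Outputs (A : LocalAlgorithm Ψ) {c n : ℕ} (N : Network Ψ.maxDeg c n) (s : Fin n → A.Cfg)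
    (y : Labeling N.graph Ψ.vOut Ψ.eOut) : Prop :=
  ∀ v, ∃ l : List (Fin Ψ.eOut), A.program (s v).state = .halt (y.node v) l ∧
    ∀ (u : Fin n) (h : N.graph.Adj v u), l[(N.ports v).idxOf u]? = some (y.half ⟨(v, u), h⟩)

/-- Within `r` rounds, the algorithm generates a valid output labeling. As a node runs in
polynomial time altogether, it also takes part in at most polynomially many rounds. -/
def Succeeds (A : LocalAlgorithm Ψ) {c n : ℕ} (r : ℕ) (N : Network Ψ.maxDeg c n)
    (x : Labeling N.graph Ψ.vIn Ψ.eIn) (ρ : A.PubCoins n) (σ : A.PrivCoins n) : Prop :=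
  ∃ y, A.Outputs N (A.run N x ρ σ (min r (A.time.eval n))) y ∧ Ψ.IsSolution x y

end LocalAlgorithm

/-! ## The preset public coins model -/

/-- A bounded adversary: a randomized circuit that, given `m` public coins, selects an input
labeling of `G` by `a` node labels and `b` half-edge labels. The labels are output in one-hot
encoding: for each node (half-edge) and each label, a wire tells whether this label is chosen. -/
structure BoundedAdversary {n : ℕ} (G : SimpleGraph (Fin n)) (a b m : ℕ) where
  coins : ℕ
  gates : List Gate
  nodeWire : Fin n → Fin a → ℕ
  halfWire : G.Dart → Fin b → ℕ
  choose : (Fin m → Bool) → (Fin coins → Bool) → Labeling G a b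
  node_spec : ∀ ρ κ v i,
    (wires gates (List.ofFn ρ ++ List.ofFn κ)).getD (nodeWire v i) false = true ↔
      (choose ρ κ).node v = i
  half_spec : ∀ ρ κ e i,
    (wires gates (List.ofFn ρ ++ List.ofFn κ)).getD (halfWire e i) false = true ↔
      (choose ρ κ).half e = i

/-- The size of a bounded adversary. -/
def BoundedAdversary.size {n : ℕ} {G : SimpleGraph (Fin n)} {a b m : ℕ}
    (B : BoundedAdversary G a b m) : ℕ := B.coins + B.gates.length

/-- `A` solves `Ψ` with probability `1 - ε(n)` in `r(n)` rounds against bounded adversaries. The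
adversary may depend on the network, and it is polynomial-time in the graph size: for every
polynomial `q`, all sufficiently large `n` and all networks of size `n`, no adversary of size at
most `q(n)` makes the success probability (over the public coins, the private coins and
the coins of the adversary) smaller than `1 - ε(n)`. -/
def SolvesBounded (c : ℕ) (Ψ : LCL) (ε : ℕ → ℝ) (r : ℕ → ℕ) (A : LocalAlgorithm Ψ) : Prop :=
  ∀ q : Polynomial ℕ, ∀ᶠ n in atTop, ∀ N : Network Ψ.maxDeg c n,
    ∀ B : BoundedAdversary N.graph Ψ.vIn Ψ.eIn (A.pubLen n), B.size ≤ q.eval n →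
      1 - ε n ≤ prob fun ω : (Fin B.coins → Bool) × A.PubCoins n × A.PrivCoins n =>
        A.Succeeds (r n) N (B.choose ω.2.1 ω.1) ω.2.1 ω.2.2

/-- `A` solves `Ψ` with probability `1 - ε(n)` in `r(n)` rounds against unbounded (deterministic)
adversaries, which are arbitrary functions from public coins to input labelings. -/
def SolvesUnbounded (c : ℕ) (Ψ : LCL) (ε : ℕ → ℝ) (r : ℕ → ℕ) (A : LocalAlgorithm Ψ) : Prop :=
  ∀ᶠ n in atTop, ∀ N : Network Ψ.maxDeg c n,
    ∀ B : A.PubCoins n → Labeling N.graph Ψ.vIn Ψ.eIn,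
      1 - ε n ≤ prob fun ω : A.PubCoins n × A.PrivCoins n =>
        A.Succeeds (r n) N (B ω.1) ω.1 ω.2

/-- `r` is an upper bound on the round complexity of `Ψ` with error `ε` against bounded
adversaries. -/
def RoundBoundedLE (c : ℕ) (Ψ : LCL) (ε : ℕ → ℝ) (r : ℕ → ℕ) : Prop :=
  ∃ A : LocalAlgorithm Ψ, SolvesBounded c Ψ ε r A

/-- `r` is an upper bound on the round complexity of `Ψ` with error `ε` against unbounded
adversaries. -/
def RoundUnboundedLE (c : ℕ) (Ψ : LCL) (ε : ℕ → ℝ) (r : ℕ → ℕ) : Prop :=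
  ∃ A : LocalAlgorithm Ψ, SolvesUnbounded c Ψ ε r A

/-- The round complexity of `Ψ` with error `ε` against bounded adversaries is strictly smaller
than the one with error `ε'` against unbounded adversaries: some number of rounds suffices for
the former task and does not suffice for the latter. -/
def RoundGap (c : ℕ) (Ψ : LCL) (ε ε' : ℕ → ℝ) : Prop :=
  ∃ r : ℕ → ℕ, RoundBoundedLE c Ψ ε r ∧ ¬ RoundUnboundedLE c Ψ ε' r

/-! ## A calculus of circuit sizes -/

theorem wires_append (gs gs' : List Gate) (x : List Bool) :
    wires (gs ++ gs') x = wires gs' (wires gs x) := by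
  simp [wires, List.foldl_append]

theorem wires_concat (gs : List Gate) (g : Gate) (x : List Bool) :
    wires (gs ++ [g]) x = wires gs x ++ [g.eval (wires gs x)] := by
  simp [wires, List.foldl_append]

@[simp] theorem length_wires (gs : List Gate) (x : List Bool) :
    (wires gs x).length = x.length + gs.length := by
  induction gs using List.reverseRecOn with
  | nil => simp [wires]
  | append_singleton gs g ih => rw [wires_concat]; simp [ih]; omega

theorem wires_getD_of_lt (gs : List Gate) (x : List Bool) {i : ℕ} (hi : i < x.length) :
    (wires gs x).getD i false = x.getD i false := by
  induction gs using List.reverseRecOn with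
  | nil => simp [wires]
  | append_singleton gs g ih =>
    rw [wires_concat, List.getD_append _ _ _ _ (by simp; omega), ih]

section Calculus

variable {X : Type} {m : ℕ} {enc : X → List.Vector Bool m}

/-- A fixed wire of the program `gs`, run on the encoding of `z`, carries the truth value of
`p z`. -/
def Computes (enc : X → List.Vector Bool m) (gs : List Gate) (p : X → Prop) : Prop :=
  ∃ i < m + gs.length, ∀ z, (wires gs (enc z).toList).getD i false = true ↔ p z

/-- Each program that computes all predicates in `F` can be extended by at most `k` gates so as
to compute all predicates in `G`. -/
def Adds (enc : X → List.Vector Bool m) (k : ℕ) (F G : Set (X → Prop)) : Prop :=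
  ∀ gs, (∀ f ∈ F, Computes enc gs f) →
    ∃ gs' : List Gate, gs'.length ≤ k ∧ ∀ g ∈ G, Computes enc (gs ++ gs') g

theorem Computes.append {gs : List Gate} {p : X → Prop} (h : Computes enc gs p)
    (gs' : List Gate) : Computes enc (gs ++ gs') p := by
  obtain ⟨i, hi, h⟩ := h
  refine ⟨i, by simp; omega, fun z => ?_⟩
  rw [wires_append, wires_getD_of_lt _ _ (by simpa using hi), h]

namespace Adds

variable {F G H : Set (X → Prop)} {k k' : ℕ}

theorem of_subset (h : G ⊆ F) : Adds enc k F G :=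
  fun _ hgs => ⟨[], by simp, fun g hg => by simpa using hgs g (h hg)⟩

theorem mono (h : Adds enc k F G) {F' G' : Set (X → Prop)} (hF : F ⊆ F') (hk : k ≤ k')
    (hG : G' ⊆ G) : Adds enc k' F' G' := by
  intro gs hgs
  obtain ⟨gs', h1, h2⟩ := h gs fun f hf => hgs f (hF hf)
  exact ⟨gs', h1.trans hk, fun g hg => h2 g (hG hg)⟩

theorem mono_cost (h : Adds enc k F G) (hk : k ≤ k') : Adds enc k' F G :=
  h.mono subset_rfl hk subset_rfl

/-- Gates are only appended, so earlier predicates stay available. Intermediate results are shared,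
and costs add up along a long simulation instead of multiplying. -/
theorem trans_union (h : Adds enc k F G) (h' : Adds enc k' (F ∪ G) H) :
    Adds enc (k + k') F H := by
  intro gs hgs
  obtain ⟨g1, h1, h2⟩ := h gs hgs
  obtain ⟨g2, h3, h4⟩ := h' (gs ++ g1) (by
    rintro f (hf | hf)
    · exact (hgs f hf).append _
    · exact h2 f hf)
  exact ⟨g1 ++ g2, by simp; omega, by simpa using h4⟩

theorem trans (h : Adds enc k F G) (h' : Adds enc k' G H) : Adds enc (k + k') F H :=
  h.trans_union (h'.mono Set.subset_union_right le_rfl subset_rfl)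

theorem union (h : Adds enc k F G) (h' : Adds enc k' F H) : Adds enc (k + k') F (G ∪ H) := by
  intro gs hgs
  obtain ⟨g1, h1, h2⟩ := h gs hgs
  obtain ⟨g2, h3, h4⟩ := h' (gs ++ g1) fun f hf => (hgs f hf).append _
  refine ⟨g1 ++ g2, by simp; omega, ?_⟩
  rw [← List.append_assoc]
  rintro f (hf | hf)
  · exact (h2 f hf).append _
  · exact h4 f hf

theorem iUnion {ι : Type} [Fintype ι] {K : ι → Set (X → Prop)} (h : ∀ i, Adds enc k F (K i)) :
    Adds enc (Fintype.card ι * k) F (⋃ i, K i) := by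
  classical
  suffices ∀ s : Finset ι, Adds enc (s.card * k) F (⋃ i ∈ s, K i) by
    simpa using this Finset.univ
  intro s
  induction s using Finset.induction_on with
  | empty => exact of_subset (by simp)
  | insert a s ha ih =>
    rw [Finset.card_insert_of_notMem ha, add_mul, one_mul, add_comm]
    simpa using (h a).union ih

theorem range {ι : Type} [Fintype ι] {p : ι → X → Prop} (h : ∀ i, Adds enc k F {p i}) :
    Adds enc (Fintype.card ι * k) F (Set.range p) :=
  (iUnion h).mono subset_rfl le_rfl (by rintro _ ⟨i, rfl⟩; simp)

theorem of_gate (g : Gate) (p : X → Prop) (gs : List Gate)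
    (h : ∀ z, g.eval (wires gs (enc z).toList) = true ↔ p z) :
    ∃ gs' : List Gate, gs'.length ≤ 1 ∧ ∀ q ∈ ({p} : Set (X → Prop)),
      Computes enc (gs ++ gs') q := by
  refine ⟨[g], by simp, ?_⟩
  rintro _ rfl
  refine ⟨m + gs.length, by simp, fun z => ?_⟩
  rw [wires_concat, List.getD_append_right _ _ _ _ (by simp)]
  simpa using h z

theorem const (c : Prop) : Adds enc 1 F {fun _ => c} := by
  classical
  exact fun gs _ => of_gate (.const (decide c)) _ gs fun z => by simp [Gate.eval]

theorem not {p : X → Prop} (h : Adds enc k F {p}) : Adds enc (k + 1) F {fun z => ¬ p z} := by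
  refine h.trans fun gs hgs => ?_
  obtain ⟨i, -, hi⟩ := hgs p rfl
  refine of_gate (.not i) _ gs fun z => ?_
  rw [← hi]; simp [Gate.eval]

theorem and {p q : X → Prop} (h : Adds enc k F {p}) (h' : Adds enc k' F {q}) :
    Adds enc (k + k' + 1) F {fun z => p z ∧ q z} := by
  refine (h.union h').trans fun gs hgs => ?_
  obtain ⟨i, -, hi⟩ := hgs p (by simp)
  obtain ⟨j, -, hj⟩ := hgs q (by simp)
  refine of_gate (.and i j) _ gs fun z => ?_
  rw [← hi, ← hj]; simp [Gate.eval]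

theorem or {p q : X → Prop} (h : Adds enc k F {p}) (h' : Adds enc k' F {q}) :
    Adds enc (k + k' + 1) F {fun z => p z ∨ q z} := by
  refine (h.union h').trans fun gs hgs => ?_
  obtain ⟨i, -, hi⟩ := hgs p (by simp)
  obtain ⟨j, -, hj⟩ := hgs q (by simp)
  refine of_gate (.or i j) _ gs fun z => ?_
  rw [← hi, ← hj]; simp [Gate.eval]

/-- The proposition `c` does not depend on the input, so it is settled when the program is written,
not by gates. Facts about the fixed network and the fixed samples enter in this non-uniform way. -/
theorem const_and (c : Prop) {p : X → Prop} (h : Adds enc k F {p}) :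
    Adds enc (k + 1) F {fun z => c ∧ p z} := by
  by_cases hc : c
  · simpa [hc] using h.mono_cost (Nat.le_succ k)
  · simpa [hc] using (const (enc := enc) (F := F) False).mono_cost (Nat.le_add_left 1 k)

theorem exists_const {c : Prop} {p : c → X → Prop} (h : ∀ hc, Adds enc k F {p hc}) :
    Adds enc (k + 1) F {fun z => ∃ hc, p hc z} := by
  by_cases hc : c
  · simpa [hc] using (h hc).mono_cost (Nat.le_succ k)
  · simpa [hc] using (const (enc := enc) (F := F) False).mono_cost (Nat.le_add_left 1 k)

theorem exists_fintype {ι : Type} [Fintype ι] {p : ι → X → Prop}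
    (h : ∀ i, Adds enc k F {p i}) :
    Adds enc (Fintype.card ι * (k + 1) + 1) F {fun z => ∃ i, p i z} := by
  classical
  suffices ∀ s : Finset ι, Adds enc (s.card * (k + 1) + 1) F {fun z => ∃ i ∈ s, p i z} by
    simpa using this Finset.univ
  intro s
  induction s using Finset.induction_on with
  | empty => simpa using const (enc := enc) (F := F) False
  | insert a s ha ih =>
    rw [Finset.card_insert_of_notMem ha]
    simpa using ((h a).or ih).mono_cost (k' := (s.card + 1) * (k + 1) + 1) (by
      rw [add_mul]; omega)

theorem forall_fintype {ι : Type} [Fintype ι] {p : ι → X → Prop}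
    (h : ∀ i, Adds enc k F {p i}) :
    Adds enc (Fintype.card ι * (k + 1) + 1) F {fun z => ∀ i, p i z} := by
  classical
  suffices ∀ s : Finset ι, Adds enc (s.card * (k + 1) + 1) F {fun z => ∀ i ∈ s, p i z} by
    simpa using this Finset.univ
  intro s
  induction s using Finset.induction_on with
  | empty => simpa using const (enc := enc) (F := F) True
  | insert a s ha ih =>
    rw [Finset.card_insert_of_notMem ha]
    simpa using ((h a).and ih).mono_cost (k' := (s.card + 1) * (k + 1) + 1) (by
      rw [add_mul]; omega)

/-- A predicate that is determined by the predicates `b i` is a disjunction of conjunctions of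
these predicates and of their negations. -/
theorem of_determined {ι : Type} [Fintype ι] (b : ι → X → Prop) (hb : ∀ i, Adds enc k F {b i})
    {p : X → Prop} (hp : ∀ z z', (∀ i, b i z ↔ b i z') → p z → p z') :
    Adds enc (2 ^ Fintype.card ι * (Fintype.card ι * (k + 2) + 3) + 1) F {p} := by
  classical
  -- Disjunctive normal form: `s` runs over the truth patterns of the `b i` that occur at some point
  -- where `p` holds. The exponential cost is harmless because it is used for families whose size
  -- does not depend on the graph size.
  have key : p = fun z => ∃ s : Finset ι, (∃ z', p z' ∧ ∀ i, i ∈ s ↔ b i z') ∧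
      ∀ i, (i ∈ s ↔ b i z) := by
    funext z
    apply propext
    constructor
    · exact fun h => ⟨Finset.univ.filter fun i => b i z, ⟨z, h, by simp⟩, by simp⟩
    · rintro ⟨s, ⟨z', h, h1⟩, h2⟩
      exact hp z' z (fun i => (h1 i).symm.trans (h2 i)) h
  have lit : ∀ (s : Finset ι) (i : ι), Adds enc (k + 1) F {fun z => i ∈ s ↔ b i z} := by
    intro s i
    by_cases hi : i ∈ s
    · simpa [hi] using (hb i).mono_cost (Nat.le_succ k)
    · simpa [hi] using (hb i).not
  rw [key]
  have := exists_fintype fun s : Finset ι =>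
    const_and (∃ z', p z' ∧ ∀ i, i ∈ s ↔ b i z') (forall_fintype (lit s))
  rw [Fintype.card_finset] at this
  exact this

/-- The wires of a program whose inputs are computed by predicates in `F`. -/
theorem of_wires (gates : List Gate) (inp : X → List Bool) {a : ℕ}
    (ha : ∀ z, (inp z).length = a)
    (hF : ∀ i, Adds enc 0 F {fun z => (inp z).getD i false = true}) :
    Adds enc gates.length F
      (Set.range fun i z => (wires gates (inp z)).getD i false = true) := by
  induction gates using List.reverseRecOn with
  | nil =>
    intro gs hgs
    refine ⟨[], by simp, ?_⟩
    rintro _ ⟨i, rfl⟩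
    obtain ⟨gs', h1, h2⟩ := hF i gs hgs
    rw [Nat.le_zero, List.length_eq_zero_iff] at h1
    simpa [h1, wires] using h2 _ rfl
  | append_singleton gates g ih =>
    rw [List.length_append, List.length_singleton]
    refine ih.trans ?_
    set W := Set.range fun i z => (wires gates (inp z)).getD i false = true
    have hW : ∀ i, Adds enc 0 W {fun z => (wires gates (inp z)).getD i false = true} :=
      fun i => of_subset (by simp [W])
    have hg : Adds enc 1 W {fun z => g.eval (wires gates (inp z)) = true} := by
      cases g with
      | const b => simpa [Gate.eval] using const (enc := enc) (F := W) (b = true)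
      | not i => simpa [Gate.eval] using (hW i).not
      | and i j => simpa [Gate.eval] using (hW i).and (hW j)
      | or i j => simpa [Gate.eval] using (hW i).or (hW j)
    refine ((of_subset (k := 0) subset_rfl).union hg).mono subset_rfl (by simp) ?_
    rintro _ ⟨i, rfl⟩
    have hlen : ∀ z, (wires gates (inp z)).length = a + gates.length := fun z => by simp [ha]
    simp only [wires_concat]
    rcases lt_trichotomy i (a + gates.length) with h | h | h
    · left
      refine ⟨i, ?_⟩
      funext z
      rw [List.getD_append _ _ _ _ (by rw [hlen]; exact h)]
    · right
      rw [Set.mem_singleton_iff]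
      funext z
      rw [List.getD_append_right _ _ _ _ (by rw [hlen, h])]
      simp [hlen, h]
    -- Beyond the last wire the value is `false` both before and after the new gate, so the old
    -- predicate with the same index serves.
    · left
      refine ⟨i, ?_⟩
      funext z
      have h1 : (wires gates (inp z)).getD i false = false :=
        List.getD_eq_default _ _ (by rw [hlen]; omega)
      have h2 : (wires gates (inp z) ++ [g.eval (wires gates (inp z))]).getD i false = false :=
        List.getD_eq_default _ _ (by simp [ha]; omega)
      simp only [h1, h2]

/-- Predicates that can be added to the input wires are computed by a program. -/
theorem exists_gates (h : Adds enc k F G)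
    (hF : ∀ f ∈ F, ∃ i < m, ∀ z, (enc z).toList.getD i false = true ↔ f z) :
    ∃ gs : List Gate, gs.length ≤ k ∧ ∀ g ∈ G, Computes enc gs g := by
  simpa using h [] fun f hf => by
    obtain ⟨i, hi, h⟩ := hF f hf
    exact ⟨i, by simpa using hi, by simpa [wires] using h⟩

end Adds

end Calculus

/-! ## Circuits for the simulation of LOCAL algorithms -/

noncomputable instance TapeIdx.instFintype (Δ k : ℕ) : Fintype (TapeIdx Δ k) :=
  Fintype.ofInjective (β := Fin 3 ⊕ Fin Δ ⊕ Fin Δ ⊕ Fin k)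
    (fun
      | .input => .inl 0
      | .priv => .inl 1
      | .pub => .inl 2
      | .inbox i => .inr (.inl i)
      | .outbox i => .inr (.inr (.inl i))
      | .work i => .inr (.inr (.inr i)))
    (by intro a b h; cases a <;> cases b <;> simp_all)

/-- The cost of `Adds.of_determined` for `d` predicates of cost `k`. -/
def determinedCost (d k : ℕ) : ℕ := 2 ^ d * (d * (k + 2) + 3) + 1

theorem determinedCost_mono {d d' k k' : ℕ} (hd : d ≤ d') (hk : k ≤ k') :
    determinedCost d k ≤ determinedCost d' k' := by
  unfold determinedCost
  gcongr
  norm_num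

theorem one_le_determinedCost (d k : ℕ) : 1 ≤ determinedCost d k := by
  simp [determinedCost]

namespace LocalAlgorithm

variable {Ψ : LCL} (A : LocalAlgorithm Ψ)

/-- The effect of one step as a function of the state and of the scanned symbols. -/
def transition (q : Fin A.numStates) (a : TapeIdx Ψ.maxDeg A.numWork → Γ') :
    Fin A.numStates × (TapeIdx Ψ.maxDeg A.numWork → Γ' × Move) :=
  match A.program q with
  | .compute δ => δ a
  | .wait _ => (q, fun T => (a T, .stay))
  | .halt _ _ => (q, fun T => (a T, .stay))

theorem step_eq (s : A.Cfg) :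
    A.step s =
      let a := A.transition s.state fun T => s.cell T (s.head T)
      { state := a.1
        head := fun T => (a.2 T).2.apply (s.head T)
        cell := fun T => Function.update (s.cell T) (s.head T) (a.2 T).1 } := by
  unfold step transition
  cases h : A.program s.state <;> simp [Move.apply]

theorem _root_.Move.apply_le (t : Move) (i : ℕ) : t.apply i ≤ i + 1 := by
  cases t <;> simp [Move.apply]; omega

theorem head_step_le (s : A.Cfg) (T : TapeIdx Ψ.maxDeg A.numWork) :
    (A.step s).head T ≤ s.head T + 1 := by
  rw [step_eq]; exact Move.apply_le _ _

theorem head_iterate_step_le (t : ℕ) (s : A.Cfg) (T : TapeIdx Ψ.maxDeg A.numWork) :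
    (A.step^[t] s).head T ≤ s.head T + t := by
  induction t with
  | zero => simp
  | succ t ih =>
    rw [Function.iterate_succ_apply']
    exact (A.head_step_le _ T).trans (by omega)

/-! ### Simulation of one node by gates -/

section NodePreds

variable {X : Type} {m : ℕ} {enc : X → List.Vector Bool m} {F : Set (X → Prop)}

/-- The predicates that describe a configuration up to position `P` of the tapes. -/
def nodePreds (P : ℕ) (c : X → A.Cfg) : Set (X → Prop) :=
  (Set.range fun q z => (c z).state = q) ∪
  (Set.range fun (i : TapeIdx Ψ.maxDeg A.numWork × Fin (P + 1)) z => (c z).head i.1 = i.2) ∪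
  (Set.range fun (i : TapeIdx Ψ.maxDeg A.numWork × Fin (P + 1) × Γ') z =>
    (c z).cell i.1 i.2.1 = i.2.2)

/-- The number of predicates in `nodePreds`. -/
noncomputable def nodeCount (P : ℕ) : ℕ :=
  A.numStates + Fintype.card (TapeIdx Ψ.maxDeg A.numWork) * (P + 1) +
    Fintype.card (TapeIdx Ψ.maxDeg A.numWork) * ((P + 1) * Fintype.card Γ')

theorem adds_nodePreds {P k : ℕ} {c : X → A.Cfg}
    (hs : ∀ q, Adds enc k F {fun z => (c z).state = q})
    (hh : ∀ T, ∀ i ≤ P, Adds enc k F {fun z => (c z).head T = i})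
    (hc : ∀ T, ∀ i ≤ P, ∀ γ, Adds enc k F {fun z => (c z).cell T i = γ}) :
    Adds enc (A.nodeCount P * k) F (A.nodePreds P c) := by
  refine (((Adds.range hs).union (Adds.range fun i : TapeIdx Ψ.maxDeg A.numWork × Fin (P + 1) =>
    hh i.1 i.2 (Nat.le_of_lt_succ i.2.2))).union
    (Adds.range fun i : TapeIdx Ψ.maxDeg A.numWork × Fin (P + 1) × Γ' =>
      hc i.1 i.2.1 (Nat.le_of_lt_succ i.2.1.2) i.2.2)).mono_cost ?_
  simp only [nodeCount, Fintype.card_prod, Fintype.card_fin, add_mul]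
  exact le_rfl

variable {A} {P : ℕ} {c : X → A.Cfg}

theorem adds_state (q : Fin A.numStates) :
    Adds enc 0 (A.nodePreds P c) {fun z => (c z).state = q} :=
  Adds.of_subset (by simp [nodePreds])

theorem adds_head (T : TapeIdx Ψ.maxDeg A.numWork) {i : ℕ} (hi : i ≤ P) :
    Adds enc 0 (A.nodePreds P c) {fun z => (c z).head T = i} :=
  Adds.of_subset <| Set.singleton_subset_iff.2 <|
    .inl <| .inr ⟨(T, ⟨i, Nat.lt_succ_of_le hi⟩), rfl⟩

theorem adds_cell (T : TapeIdx Ψ.maxDeg A.numWork) {i : ℕ} (hi : i ≤ P) (γ : Γ') :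
    Adds enc 0 (A.nodePreds P c) {fun z => (c z).cell T i = γ} :=
  Adds.of_subset <| Set.singleton_subset_iff.2 <|
    .inr ⟨(T, ⟨i, Nat.lt_succ_of_le hi⟩, γ), rfl⟩

/-- A disjunction over the `P + 1` possible head positions. This is the only ingredient of a step
whose cost grows with the length of the tapes. -/
theorem adds_scan (hP : ∀ z T, (c z).head T ≤ P) (T : TapeIdx Ψ.maxDeg A.numWork) (γ : Γ') :
    Adds enc (2 * P + 3) (A.nodePreds P c) {fun z => (c z).cell T ((c z).head T) = γ} := by
  have h := Adds.exists_fintype fun i : Fin (P + 1) =>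
    (adds_head (enc := enc) (c := c) T (Nat.le_of_lt_succ i.2)).and
      (adds_cell T (Nat.le_of_lt_succ i.2) γ)
  have e : (fun z => (c z).cell T ((c z).head T) = γ) =
      fun z => ∃ i : Fin (P + 1), (c z).head T = i ∧ (c z).cell T i = γ := by
    funext z
    apply propext
    constructor
    · exact fun h => ⟨⟨_, Nat.lt_succ_of_le (hP z T)⟩, rfl, h⟩
    · rintro ⟨i, h1, h2⟩
      rw [h1, h2]
  rw [e]
  refine h.mono_cost ?_
  simp
  omega

/-- The predicates that determine position `i` of the tape `T` after a step. -/
def stepBits (c : X → A.Cfg) (T : TapeIdx Ψ.maxDeg A.numWork) (i : ℕ) :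
    (Fin A.numStates ⊕ (TapeIdx Ψ.maxDeg A.numWork × Γ')) ⊕ (Fin 3 ⊕ Γ') → X → Prop
  | .inl (.inl q) => fun z => (c z).state = q
  | .inl (.inr j) => fun z => (c z).cell j.1 ((c z).head j.1) = j.2
  | .inr (.inl k) => fun z => (c z).head T + 1 = i + k
  | .inr (.inr γ) => fun z => (c z).cell T i = γ

variable (A) in
/-- The cost of each predicate that describes the configuration after a step. -/
noncomputable def stepCost (P : ℕ) : ℕ :=
  determinedCost (A.numStates + Fintype.card (TapeIdx Ψ.maxDeg A.numWork) * Fintype.card Γ' +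
    (3 + Fintype.card Γ')) (2 * P + 3)

/-- The transition is local: the number of predicates in `stepBits` depends only on the machine, so
the exponential in `stepCost` is a constant and `P` enters linearly. -/
theorem adds_of_stepBits (hP : ∀ z T, (c z).head T < P) (T : TapeIdx Ψ.maxDeg A.numWork)
    {i : ℕ} (hi : i ≤ P) {p : X → Prop}
    (hp : ∀ z z', (∀ j, stepBits c T i j z ↔ stepBits c T i j z') → p z → p z') :
    Adds enc (A.stepCost P) (A.nodePreds P c) {p} := by
  refine (Adds.of_determined (k := 2 * P + 3) (stepBits c T i) ?_ hp).mono_cost ?_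
  · rintro ((q | j) | (k | γ))
    · exact (adds_state q).mono_cost (Nat.zero_le _)
    · exact adds_scan (fun z T => (hP z T).le) _ _
    -- The equation says that the head is at `i - 1`, `i` or `i + 1`, written without subtraction.
    -- It is either one of the recorded head predicates or, if out of range, identically false.
    · refine Adds.mono_cost (k := 1) ?_ (by omega)
      by_cases h : i + k ≤ P + 1 ∧ 1 ≤ i + k
      · have := adds_head (enc := enc) (c := c) T (i := i + k - 1) (P := P) (by omega)
        refine (this.mono_cost (Nat.zero_le 1)).mono subset_rfl le_rfl ?_
        rw [Set.singleton_subset_singleton]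
        funext z
        simp only [stepBits, eq_iff_iff]
        omega
      · have : stepBits c T i (.inr (.inl k)) = fun _ => False := by
          funext z
          simp only [stepBits, eq_iff_iff, iff_false]
          have := hP z T
          omega
        rw [this]
        exact Adds.const _
    · exact (adds_cell T hi γ).mono_cost (Nat.zero_le _)
  · simp [stepCost, determinedCost]

theorem transition_eq_of_stepBits {T : TapeIdx Ψ.maxDeg A.numWork} {i : ℕ} {z z' : X}
    (h : ∀ j, stepBits c T i j z ↔ stepBits c T i j z') :
    (A.transition (c z).state fun T => (c z).cell T ((c z).head T)) =
      A.transition (c z').state fun T => (c z').cell T ((c z').head T) := by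
  have h1 : (c z).state = (c z').state := ((h (.inl (.inl _))).1 rfl).symm
  have h2 : (fun T => (c z).cell T ((c z).head T)) =
      fun T => (c z').cell T ((c z').head T) :=
    funext fun T =>
      ((h (.inl (.inr (T, (c z).cell T ((c z).head T))))).1 rfl).symm
  rw [h1, h2]

theorem adds_step (hP : ∀ z T, (c z).head T < P) :
    Adds enc (A.nodeCount P * A.stepCost P) (A.nodePreds P c)
      (A.nodePreds P fun z => A.step (c z)) := by
  refine A.adds_nodePreds (fun q => ?_) (fun T i hi => ?_) fun T i hi γ => ?_
  · refine adds_of_stepBits hP .input (Nat.zero_le P) fun z z' h hz => ?_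
    rw [step_eq] at hz ⊢
    rw [← hz]
    exact congrArg Prod.fst (transition_eq_of_stepBits h).symm
  · refine adds_of_stepBits hP T hi fun z z' h hz => ?_
    rw [step_eq] at hz ⊢
    have e := transition_eq_of_stepBits h
    simp only at hz ⊢
    rw [← e]
    -- A move shifts the head by at most one cell, so these three comparisons decide whether it
    -- arrives at `i`, also at the left end.
    have h0 := h (.inr (.inl 0))
    have h1 := h (.inr (.inl 1))
    have h2 := h (.inr (.inl 2))
    simp only [stepBits] at h0 h1 h2
    generalize (Prod.snd (A.transition _ _) T).2 = t at hz ⊢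
    cases t <;> simp only [Move.apply] at hz ⊢ <;> simp at h0 h1 h2 <;> omega
  · refine adds_of_stepBits hP T hi fun z z' h hz => ?_
    rw [step_eq] at hz ⊢
    have e := transition_eq_of_stepBits h
    simp only at hz ⊢
    rw [← e]
    have h1 := h (.inr (.inl 1))
    have h2 : (c z).cell T i = (c z').cell T i := ((h (.inr (.inr _))).1 rfl).symm
    simp only [stepBits] at h1
    simp at h1
    by_cases hh : (c z).head T = i
    · have hh' := h1.1 hh
      rw [hh] at hz
      rw [hh', Function.update_self]
      rwa [Function.update_self] at hz
    · have hh' := mt h1.2 hh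
      rw [Function.update_of_ne (Ne.symm hh')]
      rwa [Function.update_of_ne (Ne.symm hh), h2] at hz

theorem adds_iterate_step {H : ℕ} (hH : ∀ z T, (c z).head T ≤ H) (t : ℕ) (hP : H + t ≤ P) :
    Adds enc (t * (A.nodeCount P * A.stepCost P)) (A.nodePreds P c)
      (A.nodePreds P fun z => A.step^[t] (c z)) := by
  induction t with
  | zero => exact Adds.of_subset subset_rfl
  | succ t ih =>
    rw [add_mul, one_mul]
    simp only [Function.iterate_succ_apply']
    refine (ih (by omega)).trans (adds_step fun z T => ?_)
    have := A.head_iterate_step_le t (c z) T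
    have := hH z T
    omega

end NodePreds

/-! ### Simulation of the network by gates -/

section Network

variable {X : Type} {m : ℕ} {enc : X → List.Vector Bool m} {k n : ℕ}

/-- The predicates that describe the configurations of all nodes up to position `P`. -/
def cfgPreds (P : ℕ) (c : X → Fin n → A.Cfg) : Set (X → Prop) :=
  ⋃ v, A.nodePreds P fun z => c z v

variable {A} {P : ℕ} {c : X → Fin n → A.Cfg}

theorem nodePreds_subset_cfgPreds (v : Fin n) :
    (A.nodePreds P fun z => c z v) ⊆ A.cfgPreds P c :=
  Set.subset_iUnion (fun v => A.nodePreds P fun z => c z v) v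

theorem adds_localComputation {H : ℕ} (hH : ∀ z v T, (c z v).head T ≤ H)
    (hP : H + A.time.eval n ≤ P) :
    Adds enc (n * (A.time.eval n * (A.nodeCount P * A.stepCost P))) (A.cfgPreds P c)
      (A.cfgPreds P fun z v => A.localComputation n (c z v)) := by
  have := Adds.iUnion fun v : Fin n => (adds_iterate_step (enc := enc) (c := fun z => c z v)
    (fun z T => hH z v T) (A.time.eval n) hP).mono (nodePreds_subset_cfgPreds v) le_rfl subset_rfl
  rwa [Fintype.card_fin] at this

variable (A) in
/-- The cost of each predicate that describes the configurations after an exchange of messages. -/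
noncomputable def exchangeCost : ℕ := determinedCost (A.numStates + Fintype.card Γ') 0

theorem adds_of_state_determined {v : Fin n} {f : Fin A.numStates → Prop} :
    Adds enc A.exchangeCost (A.cfgPreds P c) {fun z => f (c z v).state} := by
  refine (Adds.of_determined (k := 0) (fun q z => (c z v).state = q)
    (fun q => (adds_state q).mono (nodePreds_subset_cfgPreds v) le_rfl subset_rfl) ?_).mono_cost
    (k' := A.exchangeCost) ?_
  · intro z z' h hz
    rwa [(h _).1 rfl]
  · rw [Fintype.card_fin]
    exact determinedCost_mono (k := 0) (Nat.le_add_right _ _) le_rfl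

theorem adds_message (u : Fin n) (o : Fin Ψ.maxDeg) {i : ℕ} (hi : i ≤ P) (γ : Γ') :
    Adds enc A.exchangeCost (A.cfgPreds P c) {fun z => A.message (c z u) o i = γ} := by
  refine (Adds.of_determined (k := 0) (fun (s : Fin A.numStates ⊕ Γ') z => match s with
    | .inl q => (c z u).state = q
    | .inr γ => (c z u).cell (.outbox o) i = γ) ?_ ?_).mono_cost (k' := A.exchangeCost) ?_
  · rintro (q | γ)
    · exact (adds_state q).mono (nodePreds_subset_cfgPreds u) le_rfl subset_rfl
    · exact (adds_cell _ hi γ).mono (nodePreds_subset_cfgPreds u) le_rfl subset_rfl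
  · intro z z' h hz
    have h1 : (c z' u).state = (c z u).state := (h (.inl _)).1 rfl
    have h2 : (c z' u).cell (.outbox o) i = (c z u).cell (.outbox o) i := (h (.inr _)).1 rfl
    rw [← hz]
    simp only [message, h1]
    cases A.program (c z u).state <;> simp [h2]
  · simp [exchangeCost, determinedCost]

theorem adds_exchange {cc : ℕ} (N : Network Ψ.maxDeg cc n) :
    Adds enc (n * (A.nodeCount P * A.exchangeCost)) (A.cfgPreds P c)
      (A.cfgPreds P fun z => A.exchange N (c z)) := by
  have := Adds.iUnion (enc := enc) (k := A.nodeCount P * A.exchangeCost) (F := A.cfgPreds P c)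
    (K := fun v : Fin n => A.nodePreds P fun z => A.exchange N (c z) v) fun v => ?_
  · rwa [Fintype.card_fin] at this
  have h1 : 1 ≤ A.exchangeCost := one_le_determinedCost _ _
  refine A.adds_nodePreds (fun q => ?_) (fun T i hi => ?_) fun T i hi γ => ?_
  · exact adds_of_state_determined (v := v) (f := fun s => (match A.program s with
      | .compute _ => s
      | .wait q => q
      | .halt _ _ => s) = q)
  · have h0 : Adds enc A.exchangeCost (A.cfgPreds P c) {fun z => (c z v).head T = i} :=
      (adds_head T hi).mono (nodePreds_subset_cfgPreds v) (Nat.zero_le _) subset_rfl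
    cases T <;> first | exact h0 | exact (Adds.const (0 = i)).mono_cost h1
  · have h0 : Adds enc A.exchangeCost (A.cfgPreds P c) {fun z => (c z v).cell T i = γ} :=
      (adds_cell T hi γ).mono (nodePreds_subset_cfgPreds v) (Nat.zero_le _) subset_rfl
    cases T with
    | inbox j =>
      simp only [exchange, received]
      by_cases hj : (j : ℕ) < (N.ports v).length
      · simp only [hj, ↓reduceDIte]
        exact adds_message _ _ hi γ
      · simp only [hj, ↓reduceDIte]
        exact (Adds.const _).mono_cost h1
    | outbox j => exact (Adds.const (tapeOf [] i = γ)).mono_cost h1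
    | input => exact h0
    | priv => exact h0
    | pub => exact h0
    | work j => exact h0

theorem head_exchange_le {cc : ℕ} (N : Network Ψ.maxDeg cc n) (s : Fin n → A.Cfg) (v : Fin n)
    (T : TapeIdx Ψ.maxDeg A.numWork) : (A.exchange N s v).head T ≤ (s v).head T := by
  cases T <;> simp [exchange]

/-- Each round has at most `A.time.eval n` steps and an exchange never moves a head to the right.
Hence finitely many tape cells, polynomially many over all rounds, need to be tracked. -/
theorem head_run_le {cc : ℕ} (N : Network Ψ.maxDeg cc n) (x : Labeling N.graph Ψ.vIn Ψ.eIn)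
    (ρ : A.PubCoins n) (σ : A.PrivCoins n) (k : ℕ) (v : Fin n)
    (T : TapeIdx Ψ.maxDeg A.numWork) :
    (A.run N x ρ σ k v).head T ≤ (k + 1) * A.time.eval n := by
  induction k with
  | zero =>
    refine (A.head_iterate_step_le _ _ T).trans ?_
    simp [initialCfg]
  | succ k ih =>
    refine (A.head_iterate_step_le _ _ T).trans ?_
    have := head_exchange_le N (A.run N x ρ σ k) v T
    rw [add_mul (k + 1)]
    omega

/-- The predicates that describe a labeling. -/
def _root_.labelPreds {G : SimpleGraph (Fin n)} {a b : ℕ} (x : X → Labeling G a b) :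
    Set (X → Prop) :=
  (Set.range fun (i : Fin n × Fin a) z => (x z).node i.1 = i.2) ∪
  (Set.range fun (i : G.Dart × Fin b) z => (x z).half i.1 = i.2)

theorem _root_.adds_node {G : SimpleGraph (Fin n)} {a b : ℕ} {x : X → Labeling G a b} {F}
    (hF : labelPreds x ⊆ F) (v : Fin n) (i : Fin a) :
    Adds enc 0 F {fun z => (x z).node v = i} :=
  Adds.of_subset (Set.singleton_subset_iff.2 (hF (.inl ⟨(v, i), rfl⟩)))

theorem _root_.adds_half {G : SimpleGraph (Fin n)} {a b : ℕ} {x : X → Labeling G a b} {F}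
    (hF : labelPreds x ⊆ F) (e : G.Dart) (i : Fin b) :
    Adds enc 0 F {fun z => (x z).half e = i} :=
  Adds.of_subset (Set.singleton_subset_iff.2 (hF (.inr ⟨(e, i), rfl⟩)))

/-- The cost of each predicate that describes the initial configurations. -/
def _root_.LCL.initialCost (Ψ : LCL) : ℕ := determinedCost (1 + (Ψ.vIn + Ψ.maxDeg * Ψ.eIn)) 2

/-- Each initial cell depends on few bits: on the labels at one node and its at most `Ψ.maxDeg`
half-edges, on a single public coin, or on nothing, since the network and the private coins `σ` are
fixed. The public coins have cost 1, not 0, because a shift may negate an input bit. -/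
theorem adds_initialCfg {cc : ℕ} (N : Network Ψ.maxDeg cc n)
    (x : X → Labeling N.graph Ψ.vIn Ψ.eIn) (ρ : X → A.PubCoins n) (σ : A.PrivCoins n)
    {F : Set (X → Prop)} (hx : labelPreds x ⊆ F)
    (hρ : ∀ i, Adds enc 1 F {fun z => ρ z i = true}) :
    Adds enc (n * (A.nodeCount P * Ψ.initialCost)) F
      (A.cfgPreds P fun z => A.initialCfg N (x z) (ρ z) σ) := by
  have := Adds.iUnion (enc := enc) (k := A.nodeCount P * Ψ.initialCost) (F := F)
    (K := fun v : Fin n => A.nodePreds P fun z => A.initialCfg N (x z) (ρ z) σ v) fun v => ?_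
  · rwa [Fintype.card_fin] at this
  have h1 : 1 ≤ Ψ.initialCost := one_le_determinedCost _ _
  refine A.adds_nodePreds (fun q => (Adds.const (A.start = q)).mono_cost h1)
    (fun T i hi => (Adds.const (0 = i)).mono_cost h1) fun T i hi γ => ?_
  cases T with
  | input =>
    simp only [initialCfg]
    refine (Adds.of_determined (k := 2) (fun (s : Fin Ψ.vIn ⊕ Fin Ψ.maxDeg × Fin Ψ.eIn) z =>
      match s with
      | .inl a => (x z).node v = a
      | .inr a => ∃ h : (a.1 : ℕ) < (N.ports v).length, (x z).half ⟨(v, (N.ports v)[a.1]),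
          (N.mem_ports v _).1 (List.getElem_mem h)⟩ = a.2) ?_ ?_).mono_cost
      (k' := Ψ.initialCost) ?_
    · rintro (a | a)
      · exact (adds_node hx v a).mono_cost (Nat.zero_le 2)
      · exact (Adds.exists_const fun h => adds_half hx _ _).mono_cost one_le_two
    · intro z z' h hz
      have e1 : (x z').node v = (x z).node v := (h (.inl _)).1 rfl
      have e2 : ∀ u : {u // u ∈ N.ports v}, (x z').half ⟨(v, u.1), (N.mem_ports v u.1).1 u.2⟩ =
          (x z).half ⟨(v, u.1), (N.mem_ports v u.1).1 u.2⟩ := by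
        rintro ⟨u, hu⟩
        obtain ⟨j, hj, rfl⟩ := List.getElem_of_mem hu
        exact ((h (.inr (⟨j, hj.trans_le (N.length_ports v)⟩, _))).1 ⟨hj, rfl⟩).2
      rw [← hz]
      simp only [inputSyms, e1, e2]
    · simp only [Fintype.card_sum, Fintype.card_prod, Fintype.card_fin]
      exact determinedCost_mono (k := 2) (Nat.le_add_left _ 1) le_rfl
  | pub =>
    simp only [initialCfg]
    -- Cell 0 holds the end marker, so coin `i - 1` sits in cell `i`. For `i = 0` the cell is
    -- constant and the truncated index does no harm.
    refine (Adds.of_determined (k := 2) (fun (_ : Fin 1) z =>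
      ∃ h : i - 1 < A.pubLen n, ρ z ⟨i - 1, h⟩ = true) ?_ ?_).mono_cost
      (k' := Ψ.initialCost) ?_
    · exact fun _ => Adds.exists_const fun h => hρ _
    · intro z z' h hz
      rw [← hz]
      cases i with
      | zero => simp [tapeOf]
      | succ i =>
        simp only [Nat.add_sub_cancel] at h
        by_cases hi : i < A.pubLen n
        · have := h 0
          simp only [hi, exists_true_left] at this
          simp [tapeOf, hi, List.getD_eq_getElem?_getD, Bool.eq_iff_iff.2 this]
        · simp [tapeOf, hi, List.getD_eq_getElem?_getD]
    · rw [Fintype.card_fin]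
      exact determinedCost_mono (k := 2) (Nat.le_add_right 1 _) le_rfl
  | priv => exact (Adds.const (tapeOf ((List.ofFn (σ v)).map Γ'.bit) i = γ)).mono_cost h1
  | inbox _ => exact (Adds.const (tapeOf [] i = γ)).mono_cost h1
  | outbox _ => exact (Adds.const (tapeOf [] i = γ)).mono_cost h1
  | work _ => exact (Adds.const (tapeOf [] i = γ)).mono_cost h1

end Network

end LocalAlgorithm

/-! ### Circuits for the success of the algorithm -/

namespace LocalAlgorithm

variable {Ψ : LCL} (A : LocalAlgorithm Ψ)

/-- The bound on the head positions in the whole computation. -/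
def headBound (n : ℕ) : ℕ := (A.time.eval n + 1) * A.time.eval n

/-- The cost of the simulation of all rounds. -/
noncomputable def runCost (n : ℕ) : ℕ :=
  n * (A.nodeCount (A.headBound n) * Ψ.initialCost) + (A.time.eval n + 1) *
    (n * (A.time.eval n * (A.nodeCount (A.headBound n) * A.stepCost (A.headBound n))) +
      n * (A.nodeCount (A.headBound n) * A.exchangeCost))

/-- In state `q`, a node has halted with output label `a`. -/
def OutNode (q : Fin A.numStates) (a : Fin Ψ.vOut) : Prop := ∃ l, A.program q = .halt a l

/-- In state `q`, a node has halted with output label `b` for the half-edge at its port `i`. -/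
def OutHalf (q : Fin A.numStates) (i : ℕ) (b : Fin Ψ.eOut) : Prop :=
  ∃ a l, A.program q = .halt a l ∧ l[i]? = some b

variable {A}

theorem OutNode.unique {q : Fin A.numStates} {a a' : Fin Ψ.vOut} (h : A.OutNode q a)
    (h' : A.OutNode q a') : a = a' := by
  obtain ⟨l, h⟩ := h
  obtain ⟨l', h'⟩ := h'
  rw [h] at h'
  injection h'

theorem OutHalf.unique {q : Fin A.numStates} {i : ℕ} {b b' : Fin Ψ.eOut} (h : A.OutHalf q i b)
    (h' : A.OutHalf q i b') : b = b' := by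
  obtain ⟨a, l, h, h1⟩ := h
  obtain ⟨a', l', h', h1'⟩ := h'
  rw [h] at h'
  injection h' with _ e
  rw [← e, h1] at h1'
  injection h1'

theorem outputs_iff {cc n : ℕ} {N : Network Ψ.maxDeg cc n} {s : Fin n → A.Cfg}
    {y : Labeling N.graph Ψ.vOut Ψ.eOut} :
    A.Outputs N s y ↔ (∀ v, A.OutNode (s v).state (y.node v)) ∧
      ∀ e : N.graph.Dart, A.OutHalf (s e.fst).state ((N.ports e.fst).idxOf e.snd) (y.half e) := by
  constructor
  · intro h
    refine ⟨fun v => ?_, fun e => ?_⟩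
    · obtain ⟨l, h, -⟩ := h v
      exact ⟨l, h⟩
    · obtain ⟨l, h, h1⟩ := h e.fst
      exact ⟨_, l, h, h1 e.snd e.adj⟩
  · rintro ⟨h1, h2⟩ v
    obtain ⟨l, hl⟩ := h1 v
    refine ⟨l, hl, fun u hu => ?_⟩
    obtain ⟨a, l', h3, h4⟩ := h2 ⟨(v, u), hu⟩
    change A.program (s v).state = _ at h3
    rw [hl] at h3
    injection h3 with _ e
    rwa [e]

/-- The neighborhood of `v`, with the outputs given by the final states, is allowed. -/
def LocallyValid {cc n : ℕ} (N : Network Ψ.maxDeg cc n) (x : Labeling N.graph Ψ.vIn Ψ.eIn)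
    (s : Fin n → A.Cfg) (v : Fin n) : Prop :=
  ∃ (H : Ψ.allowed) (f : H.1.graph ↪g N.graph),
    (Set.range f = ballAt N.graph v Ψ.radius ∧ f H.1.root = v) ∧
    ((∀ i, x.node (f i) = H.1.input.node i) ∧
      ∀ e, x.half (f.toHom.mapDart e) = H.1.input.half e) ∧
    (∀ i, A.OutNode (s (f i)).state (H.1.output.node i)) ∧
    ∀ e, A.OutHalf (s (f.toHom.mapDart e).fst).state
      ((N.ports (f.toHom.mapDart e).fst).idxOf (f.toHom.mapDart e).snd) (H.1.output.half e)

/-- A final state determines its output labels, so the quantifier over the global labeling `y`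
disappears: what remains are tests on single states and on single neighborhoods. -/
theorem exists_outputs_and_isSolution_iff {cc n : ℕ} {N : Network Ψ.maxDeg cc n}
    {x : Labeling N.graph Ψ.vIn Ψ.eIn} {s : Fin n → A.Cfg} :
    (∃ y, A.Outputs N s y ∧ Ψ.IsSolution x y) ↔
      ((∀ v, ∃ a, A.OutNode (s v).state a) ∧
        ∀ e : N.graph.Dart, ∃ b, A.OutHalf (s e.fst).state ((N.ports e.fst).idxOf e.snd) b) ∧
      ∀ v, LocallyValid N x s v := by
  constructor
  · rintro ⟨y, hy, hsol⟩
    rw [outputs_iff] at hy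
    refine ⟨⟨fun v => ⟨_, hy.1 v⟩, fun e => ⟨_, hy.2 e⟩⟩, fun v => ?_⟩
    obtain ⟨H, hH, f, h1, h2, h3, h4, h5, h6⟩ := hsol v
    exact ⟨⟨H, hH⟩, f, ⟨h1, h2⟩, ⟨h3, h4⟩, fun i => h5 i ▸ hy.1 _, fun e => h6 e ▸ hy.2 _⟩
  · rintro ⟨⟨h1, h2⟩, h3⟩
    choose yn hyn using h1
    choose yh hyh using h2
    refine ⟨⟨yn, yh⟩, outputs_iff.2 ⟨hyn, hyh⟩, fun v => ?_⟩
    obtain ⟨H, f, h4, h5, h6, h7⟩ := h3 v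
    exact ⟨H.1, H.2, f, h4.1, h4.2, h5.1, h5.2, fun i => (hyn _).unique (h6 i),
      fun e => (hyh _).unique (h7 e)⟩

theorem _root_.SimpleGraph.card_dart_le {n : ℕ} (G : SimpleGraph (Fin n)) [Fintype G.Dart] :
    Fintype.card G.Dart ≤ n * n := by
  simpa using Fintype.card_le_of_injective _ (SimpleGraph.Dart.toProd_injective (G := G))

variable {X : Type} {m : ℕ} {enc : X → List.Vector Bool m} {n : ℕ} {F : Set (X → Prop)}

variable (A) in
/-- The cost of the test whether a neighborhood is isomorphic, through a given embedding, to a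
given graph of size at most `M`. -/
noncomputable def matchCost (M : ℕ) : ℕ :=
  4 * ((M * M + M) * (A.exchangeCost + 1) + 1) + 4

variable (A) in
/-- The cost of the test whether all nodes have halted with a valid output. -/
noncomputable def validCost (M : ℕ) (n : ℕ) : ℕ :=
  (n + n * n) * (A.exchangeCost + 1) + 5 + n * (Ψ.allowed_finite.toFinset.card *
    ((n + 1) ^ M * (A.matchCost M + 1) + 2) + 1 + 1)

variable (Ψ) in
theorem _root_.LCL.exists_size_le : ∃ M, ∀ H ∈ Ψ.allowed, H.size ≤ M := by
  obtain ⟨M, hM⟩ := (Ψ.allowed_finite.image RootedLabeledGraph.size).bddAbove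
  exact ⟨M, fun H hH => hM ⟨H, hH, rfl⟩⟩

theorem adds_match {P cc : ℕ} {c : X → Fin n → A.Cfg} (N : Network Ψ.maxDeg cc n)
    {x : X → Labeling N.graph Ψ.vIn Ψ.eIn} (hx : labelPreds x ⊆ F) {M : ℕ}
    {H : RootedLabeledGraph Ψ.vIn Ψ.eIn Ψ.vOut Ψ.eOut} (hM : H.size ≤ M)
    (f : H.graph ↪g N.graph) (C : Prop) :
    Adds enc (A.matchCost M) (F ∪ A.cfgPreds P c) {fun z => C ∧
      ((∀ i, (x z).node (f i) = H.input.node i) ∧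
        ∀ e, (x z).half (f.toHom.mapDart e) = H.input.half e) ∧
      (∀ i, A.OutNode (c z (f i)).state (H.output.node i)) ∧
      ∀ e, A.OutHalf (c z (f.toHom.mapDart e).fst).state
        ((N.ports (f.toHom.mapDart e).fst).idxOf (f.toHom.mapDart e).snd)
        (H.output.half e)} := by
  classical
  have hst : ∀ (v : Fin n) (p : Fin A.numStates → Prop),
      Adds enc A.exchangeCost (F ∪ A.cfgPreds P c) {fun z => p (c z v).state} :=
    fun v p => adds_of_state_determined.mono Set.subset_union_right le_rfl subset_rfl
  have hx' : labelPreds x ⊆ F ∪ A.cfgPreds P c := hx.trans Set.subset_union_left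
  refine (Adds.const_and C (((Adds.forall_fintype fun i => adds_node hx' _ _).and
    (Adds.forall_fintype fun e => adds_half hx' _ _)).and
    ((Adds.forall_fintype fun i => hst (f i) fun q => A.OutNode q (H.output.node i)).and
      (Adds.forall_fintype fun e => hst (f.toHom.mapDart e).fst fun q => A.OutHalf q
        ((N.ports (f.toHom.mapDart e).fst).idxOf (f.toHom.mapDart e).snd)
        (H.output.half e))))).mono_cost ?_
  have h1 : Fintype.card H.graph.Dart ≤ M * M :=
    H.graph.card_dart_le.trans (Nat.mul_le_mul hM hM)
  rw [Fintype.card_fin, matchCost]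
  generalize A.exchangeCost = E
  generalize Fintype.card H.graph.Dart = d at *
  have h2 : H.size * (0 + 1) ≤ (M * M + M) * (E + 1) := by gcongr <;> omega
  have h3 : d * (0 + 1) ≤ (M * M + M) * (E + 1) := by gcongr <;> omega
  have h4 : H.size * (E + 1) ≤ (M * M + M) * (E + 1) := by gcongr; omega
  have h5 : d * (E + 1) ≤ (M * M + M) * (E + 1) := by gcongr; omega
  omega

/-- All embeddings of the allowed graphs are tried. These graphs have bounded size, so there are
only polynomially many embeddings. -/
theorem adds_locallyValid {P cc : ℕ} {c : X → Fin n → A.Cfg} (N : Network Ψ.maxDeg cc n)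
    {x : X → Labeling N.graph Ψ.vIn Ψ.eIn} (hx : labelPreds x ⊆ F) {M : ℕ}
    (hM : ∀ H ∈ Ψ.allowed, H.size ≤ M) (v : Fin n) :
    Adds enc (Ψ.allowed_finite.toFinset.card * ((n + 1) ^ M * (A.matchCost M + 1) + 2) + 1)
      (F ∪ A.cfgPreds P c) {fun z => LocallyValid N (x z) (c z) v} := by
  have := Ψ.allowed_finite.fintype
  have hcard : Ψ.allowed_finite.toFinset.card = Fintype.card Ψ.allowed := by
    rw [← Nat.card_eq_card_finite_toFinset, Nat.card_eq_fintype_card]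
  rw [hcard]
  refine Adds.exists_fintype fun H => ?_
  have inj : Function.Injective fun (f : H.1.graph ↪g N.graph) => (f : Fin H.1.size → Fin n) :=
    DFunLike.coe_injective
  let _ := Fintype.ofInjective _ inj
  refine (Adds.exists_fintype fun f => adds_match N hx (hM _ H.2) f _).mono_cost ?_
  have h := Fintype.card_le_of_injective _ inj
  rw [Fintype.card_fun, Fintype.card_fin, Fintype.card_fin] at h
  -- The base `n + 1` is positive even for `n = 0`, which makes the power monotone in the exponent.
  have h2 : n ^ H.1.size ≤ (n + 1) ^ M :=
    (Nat.pow_le_pow_left (Nat.le_succ n) _).trans (Nat.pow_le_pow_right (by omega) (hM _ H.2))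
  gcongr
  exact h.trans h2

variable (A) in
/-- The cost of the test whether the algorithm succeeds. -/
noncomputable def succeedsCost (M n : ℕ) : ℕ := A.runCost n + A.validCost M n

theorem adds_run {cc : ℕ} (N : Network Ψ.maxDeg cc n)
    (x : X → Labeling N.graph Ψ.vIn Ψ.eIn) (ρ : X → A.PubCoins n) (σ : A.PrivCoins n)
    (hx : labelPreds x ⊆ F) (hρ : ∀ i, Adds enc 1 F {fun z => ρ z i = true})
    {k : ℕ} (hk : k ≤ A.time.eval n) :
    Adds enc (A.runCost n) F
      (A.cfgPreds (A.headBound n) fun z => A.run N (x z) (ρ z) σ k) := by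
  have hT : ∀ j ≤ A.time.eval n, j * A.time.eval n + A.time.eval n ≤ A.headBound n := by
    intro j hj
    rw [headBound, ← Nat.succ_mul]
    gcongr
    omega
  suffices ∀ k ≤ A.time.eval n, Adds enc (n * (A.nodeCount (A.headBound n) * Ψ.initialCost) +
      (k + 1) * (n * (A.time.eval n * (A.nodeCount (A.headBound n) * A.stepCost (A.headBound n)))
        + n * (A.nodeCount (A.headBound n) * A.exchangeCost))) F
      (A.cfgPreds (A.headBound n) fun z => A.run N (x z) (ρ z) σ k) by
    refine (this k hk).mono_cost ?_
    unfold runCost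
    gcongr
  clear hk
  intro k hk
  induction k with
  | zero =>
    refine ((adds_initialCfg N x ρ σ hx hρ).trans
      (adds_localComputation (H := 0) ?_ ?_)).mono_cost ?_
    · simp [initialCfg]
    · simpa using hT 0 (Nat.zero_le _)
    · omega
  | succ k ih =>
    refine ((ih (by omega)).trans ((adds_exchange N).trans
      (adds_localComputation (H := (k + 1) * A.time.eval n) ?_ (hT _ hk)))).mono_cost ?_
    · exact fun z v T => (head_exchange_le N _ v T).trans (head_run_le N _ _ _ _ v T)
    · rw [add_mul (k + 1)]
      omega

theorem adds_succeeds {cc : ℕ} (N : Network Ψ.maxDeg cc n)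
    (x : X → Labeling N.graph Ψ.vIn Ψ.eIn) (ρ : X → A.PubCoins n) (σ : A.PrivCoins n)
    (hx : labelPreds x ⊆ F) (hρ : ∀ i, Adds enc 1 F {fun z => ρ z i = true})
    {M : ℕ} (hM : ∀ H ∈ Ψ.allowed, H.size ≤ M) (r : ℕ) :
    Adds enc (A.succeedsCost M n) F {fun z => A.Succeeds r N (x z) (ρ z) σ} := by
  classical
  refine (adds_run N x ρ σ hx hρ (Nat.min_le_right r _)).trans_union ?_
  simp only [Succeeds, exists_outputs_and_isSolution_iff]
  set c := fun z => A.run N (x z) (ρ z) σ (min r (A.time.eval n))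
  have hst : ∀ (v : Fin n) (p : Fin A.numStates → Prop), Adds enc A.exchangeCost
      (F ∪ A.cfgPreds (A.headBound n) c) {fun z => p (c z v).state} :=
    fun v p => adds_of_state_determined.mono Set.subset_union_right le_rfl subset_rfl
  refine (((Adds.forall_fintype fun v => hst v fun q => ∃ a, A.OutNode q a).and
    (Adds.forall_fintype fun e : N.graph.Dart => hst e.fst fun q => ∃ b, A.OutHalf q
      ((N.ports e.fst).idxOf e.snd) b)).and
    (Adds.forall_fintype fun v => adds_locallyValid N hx hM v)).mono_cost ?_
  have := N.graph.card_dart_le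
  rw [Fintype.card_fin, validCost, add_mul n (n * n)]
  have := Nat.mul_le_mul_right (A.exchangeCost + 1) this
  omega

end LocalAlgorithm

/-! ## Probability on finite sample spaces -/

section Prob

variable {Ω Ω' : Type} [Fintype Ω] [Fintype Ω']

theorem prob_eq_card (E : Ω → Prop) [DecidablePred E] :
    prob E = ((Finset.univ.filter E).card : ℝ) / Fintype.card Ω := by
  unfold prob
  congr!

theorem prob_nonneg (E : Ω → Prop) : 0 ≤ prob E := by unfold prob; positivity

theorem prob_le_one (E : Ω → Prop) : prob E ≤ 1 := by
  classical
  unfold prob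
  refine div_le_one_of_le₀ ?_ (by positivity)
  exact_mod_cast Finset.card_filter_le _ _

theorem prob_mono {E E' : Ω → Prop} (h : ∀ ω, E ω → E' ω) : prob E ≤ prob E' := by
  classical
  unfold prob
  gcongr
  exact h _

theorem prob_not [Nonempty Ω] (E : Ω → Prop) : prob (fun ω => ¬ E ω) = 1 - prob E := by
  classical
  have h := Finset.card_filter_add_card_filter_not (s := (Finset.univ : Finset Ω)) E
  have hc : (Fintype.card Ω : ℝ) ≠ 0 := by exact_mod_cast Fintype.card_ne_zero
  rw [prob_eq_card, prob_eq_card]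
  rw [eq_sub_iff_add_eq, ← add_div, div_eq_one_iff_eq hc]
  rw [Finset.card_univ] at h
  rw [← h]
  push_cast
  rw [add_comm]

theorem prob_exists_le {ι : Type} [Fintype ι] (E : ι → Ω → Prop) :
    prob (fun ω => ∃ i, E i ω) ≤ ∑ i, prob (E i) := by
  classical
  simp only [prob_eq_card]
  rw [← Finset.sum_div]
  gcongr
  norm_cast
  have : (Finset.univ.filter fun ω => ∃ i, E i ω) =
      Finset.univ.biUnion fun i => Finset.univ.filter (E i) := by
    ext ω; simp
  rw [this]
  exact Finset.card_biUnion_le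

theorem prob_or_le (E E' : Ω → Prop) : prob (fun ω => E ω ∨ E' ω) ≤ prob E + prob E' := by
  classical
  simp only [prob_eq_card]
  rw [← add_div, Finset.filter_or]
  gcongr
  exact_mod_cast Finset.card_union_le _ _

theorem prob_equiv (e : Ω ≃ Ω') (E : Ω' → Prop) : prob (fun ω => E (e ω)) = prob E := by
  classical
  unfold prob
  rw [Fintype.card_congr e]
  congr 2
  exact Finset.card_bij (fun ω _ => e ω) (by simp) (by simp)
    fun b hb => ⟨e.symm b, by simpa using hb⟩

theorem exists_not_of_prob_lt_one [Nonempty Ω] {E : Ω → Prop} (h : prob E < 1) :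
    ∃ ω, ¬ E ω := by
  by_contra! hE
  have := prob_not E
  have h0 : prob (fun ω => ¬ E ω) = 0 := by simp [prob, hE]
  linarith

theorem prob_pi {t : ℕ} (Q : Ω → Prop) :
    prob (fun s : Fin t → Ω => ∀ a, Q (s a)) = prob Q ^ t := by
  classical
  simp only [prob_eq_card]
  have : (Finset.univ.filter fun s : Fin t → Ω => ∀ a, Q (s a)) =
      Fintype.piFinset fun _ => Finset.univ.filter Q := by
    ext s; simp [Fintype.mem_piFinset]
  rw [this, Fintype.card_piFinset_const, Fintype.card_fun, Fintype.card_fin, div_pow]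
  push_cast
  rfl

theorem prob_prod (E : Ω → Ω' → Prop) :
    prob (fun ω : Ω × Ω' => E ω.1 ω.2) = (∑ a, prob (E a)) / Fintype.card Ω := by
  classical
  unfold prob
  rw [← Finset.sum_div, div_div, Fintype.card_prod]
  push_cast
  rw [mul_comm (Fintype.card Ω : ℝ)]
  congr 1
  norm_cast
  simp only [Finset.card_filter]
  exact Fintype.sum_prod_type _

theorem prob_eq_sum (E : Ω → Prop) [DecidablePred E] :
    prob E = (∑ a, if E a then (1 : ℝ) else 0) / Fintype.card Ω := by
  unfold prob
  rw [Finset.sum_boole]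
  congr!

/-- Markov's inequality in product form: it turns frequent refutations into a failure probability of
the algorithm. -/
theorem mul_prob_le_prob_prod (E : Ω → Ω' → Prop) {τ : ℝ} {Q : Ω → Prop}
    (hQ : ∀ a, Q a → τ ≤ prob (E a)) :
    prob Q * τ ≤ prob (fun ω : Ω × Ω' => E ω.1 ω.2) := by
  classical
  rw [prob_prod, prob_eq_sum, div_mul_eq_mul_div, Finset.sum_mul]
  gcongr with a
  split_ifs with h
  · simpa using hQ a h
  · simpa using prob_nonneg _

/-- Averaging: the fibres of probability below `τ` contribute at most `τ`. It turns an average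
failure probability into many public strings with a bad input. -/
theorem prob_prod_le_add [Nonempty Ω] (E : Ω → Ω' → Prop) {τ : ℝ} (hτ : 0 ≤ τ) :
    prob (fun ω : Ω × Ω' => E ω.1 ω.2) ≤ prob (fun a => τ ≤ prob (E a)) + τ := by
  classical
  have hc : (0 : ℝ) < Fintype.card Ω := by exact_mod_cast Fintype.card_pos
  rw [prob_prod, prob_eq_sum, div_add' _ _ _ hc.ne']
  gcongr
  rw [mul_comm τ, ← nsmul_eq_mul, ← Finset.card_univ, ← Finset.sum_const,
    ← Finset.sum_add_distrib]
  gcongr with a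
  split_ifs with h
  · linarith [prob_le_one (E a)]
  · linarith

theorem pow_mul_le_half_pow {q : ℝ} (hq : 0 ≤ q) {D : ℕ} (hD : 1 ≤ D) (h : q ≤ 1 - 1 / D)
    (s : ℕ) : q ^ (D * s) ≤ (1 / 2) ^ s := by
  rw [pow_mul]
  refine pow_le_pow_left₀ (by positivity) ?_ s
  calc q ^ D ≤ (1 - 1 / D) ^ D := pow_le_pow_left₀ hq h D
    _ ≤ Real.exp (-1) := Real.one_sub_div_pow_le_exp_neg (by exact_mod_cast hD)
    _ ≤ 1 / 2 := by
      rw [Real.exp_neg, one_div]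
      have := Real.exp_one_gt_d9
      gcongr
      linarith

theorem one_sub_pow_le {q : ℝ} (h1 : q ≤ 1) (t : ℕ) : 1 - (1 - q) ^ t ≤ t * q := by
  have := one_add_mul_le_pow (a := -q) (by linarith) t
  rw [← sub_eq_add_neg] at this
  linarith

/-- Finitely many samples separate the likely events from the unlikely ones, for all events of a
finite family at once. -/
theorem exists_samples {I S : Type} [Fintype I] [Fintype S] [Nonempty S] (E : I → S → Prop)
    {M D : ℕ} (hI : Fintype.card I ≤ 2 ^ M) (hD : 1 ≤ D) :
    ∃ σ : Fin (M + 2) → Fin (D * (2 * M + 4)) → S, ∀ i,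
      (1 / D ≤ prob (E i) → ∀ a, ∃ b, E i (σ a b)) ∧
      ((∀ a, ∃ b, E i (σ a b)) → 1 / (2 * (D * (2 * M + 4) : ℕ)) ≤ prob (E i)) := by
  classical
  set g := D * (2 * M + 4) with hg
  have hg0 : (0 : ℝ) < g := by
    have : 0 < g := by positivity
    exact_mod_cast this
  -- For one event of probability q, both errors are at most 2^-(M+2). If q ≥ 1/D, a group is missed
  -- with probability at most 2^-(2M+4), and there are M + 2 ≤ 2^(M+2) groups. If q < 1/(2g), a
  -- group is hit with probability at most gq ≤ 1/2, and the M + 2 groups are independent.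
  have h1 : ∀ i, prob (fun σ : Fin (M + 2) → Fin g → S =>
      (1 / D ≤ prob (E i) ∧ ∃ a, ∀ b, ¬ E i (σ a b)) ∨
      (prob (E i) < 1 / (2 * g) ∧ ∀ a, ∃ b, E i (σ a b))) ≤ 2 * (1 / 2) ^ (M + 2) := by
    intro i
    have hgroup : prob (fun G : Fin g → S => ∃ b, E i (G b)) = 1 - (1 - prob (E i)) ^ g := by
      rw [← prob_not, ← prob_pi, ← prob_not]
      simp
    have hb : prob (fun G : Fin g → S => ∀ b, ¬ E i (G b)) = (1 - prob (E i)) ^ g := by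
      rw [← prob_not, ← prob_pi]
    have hall : prob (fun σ : Fin (M + 2) → Fin g → S => ∀ a, ∃ b, E i (σ a b)) =
        (1 - (1 - prob (E i)) ^ g) ^ (M + 2) := by
      rw [← hgroup, ← prob_pi]
    have hq0 := prob_nonneg (E i)
    have hq1 := prob_le_one (E i)
    refine (prob_or_le _ _).trans ?_
    rw [two_mul ((1 / 2 : ℝ) ^ (M + 2))]
    refine add_le_add ?_ ?_
    · by_cases h : 1 / D ≤ prob (E i)
      · have e : prob (fun σ : Fin (M + 2) → Fin g → S => ∃ a, ∀ b, ¬ E i (σ a b)) =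
            1 - (1 - (1 - prob (E i)) ^ g) ^ (M + 2) := by
          rw [← hall, ← prob_not]
          simp
        simp only [h, true_and]
        rw [e]
        have h2 : (1 - prob (E i)) ^ g ≤ (1 / 2) ^ (2 * M + 4) :=
          pow_mul_le_half_pow (by linarith) hD (by linarith) _
        have h3 : ((M + 2 : ℕ) : ℝ) ≤ 2 ^ (M + 2) := by
          exact_mod_cast Nat.lt_two_pow_self.le
        calc _ ≤ ((M + 2 : ℕ) : ℝ) * (1 - prob (E i)) ^ g :=
              one_sub_pow_le (pow_le_one₀ (by linarith) (by linarith)) _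
          _ ≤ 2 ^ (M + 2) * (1 / 2) ^ (2 * M + 4) := by gcongr
          _ = (1 / 2) ^ (M + 2) := by
            rw [show 2 * M + 4 = (M + 2) + (M + 2) by ring, pow_add (1 / 2 : ℝ), ← mul_assoc,
              ← mul_pow]
            norm_num
      · simp only [h, false_and]
        simp [prob]
    · by_cases h : prob (E i) < 1 / (2 * g)
      · simp only [h, true_and]
        rw [hall]
        refine pow_le_pow_left₀ (sub_nonneg.2 (pow_le_one₀ (by linarith) (by linarith))) ?_ _
        calc _ ≤ g * prob (E i) := one_sub_pow_le hq1 _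
          _ ≤ g * (1 / (2 * g)) := by gcongr
          _ = 1 / 2 := by field_simp
      · simp only [h, false_and]
        simp [prob]
  obtain ⟨σ, hσ⟩ := exists_not_of_prob_lt_one (Ω := Fin (M + 2) → Fin g → S)
    (E := fun σ => ∃ i, (1 / D ≤ prob (E i) ∧ ∃ a, ∀ b, ¬ E i (σ a b)) ∨
      (prob (E i) < 1 / (2 * g) ∧ ∀ a, ∃ b, E i (σ a b))) (by
    refine (prob_exists_le _).trans_lt ?_
    -- Union bound over at most 2^M events with two errors each: the total is at most 1/2, so some
    -- choice of samples has no error at all.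
    calc _ ≤ ∑ i : I, 2 * (1 / 2 : ℝ) ^ (M + 2) := Finset.sum_le_sum fun i _ => h1 i
      _ = Fintype.card I * (2 * (1 / 2 : ℝ) ^ (M + 2)) := by simp
      _ ≤ (2 ^ M : ℕ) * (2 * (1 / 2 : ℝ) ^ (M + 2)) := by gcongr
      _ = (2 * (1 / 2)) ^ M * (1 / 2) := by rw [mul_pow]; push_cast; ring
      _ < 1 := by norm_num)
  push Not at hσ
  refine ⟨σ, fun i => ⟨fun h => (hσ i).1 h, fun h => ?_⟩⟩
  by_contra! hlt
  obtain ⟨a, ha⟩ := (hσ i).2 hlt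
  obtain ⟨b, hb⟩ := h a
  exact ha b hb

/-- The bitwise exclusive or of two bit strings of the same length. -/
def xorEquiv {m : ℕ} (s : Fin m → Bool) : (Fin m → Bool) ≃ (Fin m → Bool) where
  toFun ρ i := xor (ρ i) (s i)
  invFun ρ i := xor (ρ i) (s i)
  left_inv ρ := by funext i; simp
  right_inv ρ := by funext i; simp

/-- Few translates of a dense set of bit strings cover all bit strings. -/
theorem exists_shifts {m D : ℕ} (Good : (Fin m → Bool) → Prop) (hD : 1 ≤ D)
    (h : 1 / D ≤ prob Good) :
    ∃ s : Fin (D * (m + 1)) → Fin m → Bool, ∀ ρ, ∃ j, Good (xorEquiv (s j) ρ) := by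
  -- For fixed `ρ` and a uniform shift the translate is uniform, so `D * (m + 1)` independent shifts
  -- all miss the set with probability at most 2^-(m+1). A union bound over the 2^m strings `ρ`
  -- follows.
  have h1 : ∀ ρ : Fin m → Bool, prob (fun s : Fin (D * (m + 1)) → Fin m → Bool =>
      ∀ j, ¬ Good (xorEquiv (s j) ρ)) ≤ (1 / 2) ^ (m + 1) := by
    intro ρ
    have e : prob (fun s => ¬ Good (xorEquiv s ρ)) = 1 - prob Good := by
      rw [prob_not, ← prob_equiv (xorEquiv ρ) Good]
      congr 3
      funext s
      congr 1
      funext i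
      exact Bool.xor_comm _ _
    rw [prob_pi fun s => ¬ Good (xorEquiv s ρ), e]
    have := prob_le_one Good
    exact pow_mul_le_half_pow (by linarith) hD (by linarith) _
  obtain ⟨s, hs⟩ := exists_not_of_prob_lt_one (Ω := Fin (D * (m + 1)) → Fin m → Bool)
    (E := fun s => ∃ ρ, ∀ j, ¬ Good (xorEquiv (s j) ρ)) (by
    refine (prob_exists_le _).trans_lt ?_
    calc _ ≤ ∑ ρ : Fin m → Bool, (1 / 2 : ℝ) ^ (m + 1) := Finset.sum_le_sum fun ρ _ => h1 ρ
      _ = (2 * (1 / 2)) ^ m * (1 / 2) := by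
        rw [mul_pow]
        simp
        ring_nf
        rw [← mul_pow]
        norm_num
      _ < 1 := by norm_num)
  push Not at hs
  exact ⟨s, hs⟩

/-- Against an adversary `B` that makes the event `E` likely, there are samples of the private
coins and shifts of the public coins with which likely events are recognized for all inputs and
occur for all public coins. -/
theorem exists_samples_and_shifts {m M d : ℕ} {I S : Type} [Fintype I] [Fintype S] [Nonempty S]
    (E : (Fin m → Bool) → I → S → Prop) (hI : Fintype.card I ≤ 2 ^ M) (hd : 1 ≤ d)
    (B : (Fin m → Bool) → I)
    (hB : 1 / d ≤ prob fun ω : (Fin m → Bool) × S => E ω.1 (B ω.1) ω.2) :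
    ∃ (σ : Fin (m + M + 2) → Fin (2 * d * (2 * (m + M) + 4)) → S)
      (s : Fin (2 * d * (m + 1)) → Fin m → Bool),
      (∀ ρ, ∃ j x, ∀ a, ∃ b, E (xorEquiv (s j) ρ) x (σ a b)) ∧
      ∀ ρ x, (∀ a, ∃ b, E ρ x (σ a b)) →
        1 / (2 * (2 * d * (2 * (m + M) + 4) : ℕ)) ≤ prob (E ρ x) := by
  have hD : 1 ≤ 2 * d := by omega
  -- The union bound runs over the pairs of a public string and an input, whence `m + M`: the same
  -- samples must serve every shift and every instance.
  obtain ⟨σ, hσ⟩ := exists_samples (fun i : (Fin m → Bool) × I => E i.1 i.2) (M := m + M) (by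
    rw [Fintype.card_prod, pow_add]
    exact Nat.mul_le_mul (by simp) hI) hD
  have hhalf : (1 / d : ℝ) = 1 / (2 * d : ℕ) + 1 / (2 * d : ℕ) := by
    have : (d : ℝ) ≠ 0 := by positivity
    push_cast
    field_simp
    norm_num
  -- The failure probability 1/d is split in halves: one is the threshold for a single public
  -- string, the other the density of the strings that reach it.
  have hgood : (1 / (2 * d : ℕ) : ℝ) ≤ prob fun ρ => ∃ x, ∀ a, ∃ b, E ρ x (σ a b) := by
    have h1 := hB.trans (prob_prod_le_add (fun ρ => E ρ (B ρ))
      (τ := 1 / (2 * d : ℕ)) (by positivity))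
    rw [hhalf] at h1
    exact (le_of_add_le_add_right h1).trans
      (prob_mono fun ρ hρ => ⟨B ρ, (hσ (ρ, B ρ)).1 hρ⟩)
  obtain ⟨s, hs⟩ := exists_shifts _ hD hgood
  exact ⟨σ, s, hs, fun ρ x => (hσ (ρ, x)).2⟩

end Prob

/-! ## Encodings of labelings by bit strings -/

section Encoding

open Classical in
/-- An element with the property `p`, or else `d`. -/
noncomputable def pick {α : Type} (d : α) (p : α → Prop) : α :=
  if h : ∃ i, p i then h.choose else d

theorem pick_eq {α : Type} (d i : α) : pick d (fun j => i = j) = i := by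
  unfold pick
  rw [dif_pos ⟨i, rfl⟩]
  exact (Exists.choose_spec (⟨i, rfl⟩ : ∃ j, i = j)).symm

/-- The length of the encoding of a labeling by `a` node labels and `b` half-edge labels. -/
def labelLen (n a b : ℕ) : ℕ := n * a + n * n * b

/-- The positions in the encoding of a labeling. -/
noncomputable def labelPos (n a b : ℕ) :
    (Fin n × Fin a) ⊕ ((Fin n × Fin n) × Fin b) ≃ Fin (labelLen n a b) :=
  Fintype.equivFinOfCardEq (by simp [labelLen])

variable {n a b : ℕ} {G : SimpleGraph (Fin n)}

/-- The labeling that is encoded by a bit string; `x₀` provides default values. -/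
noncomputable def decodeLabeling (x₀ : Labeling G a b) (w : List Bool) : Labeling G a b where
  node v := pick (x₀.node v) fun i => w.getD (labelPos n a b (.inl (v, i))) false = true
  half e := pick (x₀.half e) fun i => w.getD (labelPos n a b (.inr (e.toProd, i))) false = true

/-- One-hot encoding. Half-edges are addressed by ordered pairs of nodes, and the bits at
non-adjacent pairs are never read. Since decoding is total and onto, every string of the right
length is a legitimate candidate solution. -/
theorem exists_decodeLabeling_eq (x₀ x : Labeling G a b) :
    ∃ w : Fin (labelLen n a b) → Bool, decodeLabeling x₀ (List.ofFn w) = x := by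
  classical
  refine ⟨fun k => match (labelPos n a b).symm k with
    | .inl i => decide (x.node i.1 = i.2)
    | .inr i => decide (∃ h : G.Adj i.1.1 i.1.2, x.half ⟨i.1, h⟩ = i.2), ?_⟩
  have key : ∀ (f : Fin (labelLen n a b) → Bool) k, (List.ofFn f).getD (k : Fin _) false = f k := by
    intro f k
    simp [List.getD_eq_getElem?_getD]
  cases x with | mk xn xh
  unfold decodeLabeling
  congr 1
  · funext v
    simp only [key, Equiv.symm_apply_apply, decide_eq_true_eq]
    exact pick_eq _ _
  · funext e
    simp only [key, Equiv.symm_apply_apply, decide_eq_true_eq]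
    rw [← pick_eq (x₀.half e) (xh e)]
    congr 1
    funext i
    apply propext
    exact ⟨fun ⟨_, h⟩ => h, fun h => ⟨e.adj, h⟩⟩

theorem exists_fintype_labeling (x₀ : Labeling G a b) :
    ∃ _ : Fintype (Labeling G a b), Fintype.card (Labeling G a b) ≤ 2 ^ labelLen n a b := by
  classical
  have hs : Function.Surjective fun w : Fin (labelLen n a b) → Bool =>
    decodeLabeling x₀ (List.ofFn w) := exists_decodeLabeling_eq x₀
  refine ⟨Fintype.ofSurjective _ hs, ?_⟩
  let _ := Fintype.ofSurjective _ hs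
  simpa using Fintype.card_le_of_surjective _ hs

variable {X : Type} {m : ℕ} {enc : X → List.Vector Bool m} {F : Set (X → Prop)} {k : ℕ}

/-- Each label is a function of its own one-hot block, whose length is a constant of the problem.
Hence even the arbitrary choice made by `pick` on malformed blocks costs only a constant. -/
theorem adds_decodeLabeling (x₀ : Labeling G a b) {w : X → List Bool}
    (hw : ∀ i, Adds enc k F {fun z => (w z).getD i false = true}) :
    Adds enc (labelLen n a b * determinedCost (a + b) k) F
      (labelPreds fun z => decodeLabeling x₀ (w z)) := by
  classical
  refine ((Adds.range fun i : Fin n × Fin a =>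
    (Adds.of_determined (fun j : Fin a => fun z =>
      (w z).getD (labelPos n a b (.inl (i.1, j))) false = true) (fun j => hw _)
      ?_).mono_cost (k' := determinedCost (a + b) k) ?_).union
    (Adds.range fun i : G.Dart × Fin b =>
    (Adds.of_determined (fun j : Fin b => fun z =>
      (w z).getD (labelPos n a b (.inr (i.1.toProd, j))) false = true) (fun j => hw _)
      ?_).mono_cost (k' := determinedCost (a + b) k) ?_)).mono_cost ?_
  · intro z z' h hz
    simpa only [decodeLabeling, h] using hz
  · rw [Fintype.card_fin]
    exact determinedCost_mono (Nat.le_add_right a b) le_rfl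
  · intro z z' h hz
    simpa only [decodeLabeling, h] using hz
  · rw [Fintype.card_fin]
    exact determinedCost_mono (Nat.le_add_left b a) le_rfl
  · rw [← add_mul, labelLen]
    simp only [Fintype.card_prod, Fintype.card_fin]
    gcongr
    exact G.card_dart_le

theorem adds_getD_append {u v : X → List Bool} {l : ℕ} (hl : ∀ z, (u z).length = l)
    (hu : ∀ i, Adds enc k F {fun z => (u z).getD i false = true})
    (hv : ∀ i, Adds enc k F {fun z => (v z).getD i false = true}) (i : ℕ) :
    Adds enc k F {fun z => (u z ++ v z).getD i false = true} := by
  by_cases hi : i < l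
  · convert hu i using 4 with z
    rw [List.getD_append _ _ _ _ (by rwa [hl])]
  · convert hv (i - l) using 4 with z
    rw [List.getD_append_right _ _ _ _ (by rw [hl]; omega), hl]

theorem adds_getD_ofFn {l : ℕ} {u : X → Fin l → Bool}
    (hu : ∀ i, Adds enc 1 F {fun z => u z i = true}) (i : ℕ) :
    Adds enc 1 F {fun z => (List.ofFn (u z)).getD i false = true} := by
  by_cases hi : i < l
  · simpa [List.getD_eq_getElem?_getD, hi] using hu ⟨i, hi⟩
  · simpa [List.getD_eq_getElem?_getD, hi] using Adds.const (enc := enc) (F := F) False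

theorem adds_getD_range {l : ℕ} {u : X → List Bool} (hl : ∀ z, (u z).length = l)
    (hu : ∀ i, Adds enc k F {fun z => (u z).getD i false = true}) :
    Adds enc (l * k + 1) F (Set.range fun i z => (u z).getD i false = true) := by
  have := (Adds.range fun i : Fin l => hu i).union (Adds.const False)
  rw [Fintype.card_fin] at this
  refine this.mono subset_rfl le_rfl ?_
  rintro _ ⟨i, rfl⟩
  by_cases hi : i < l
  · exact .inl ⟨⟨i, hi⟩, rfl⟩
  · right
    rw [Set.mem_singleton_iff]
    funext z
    have : (u z).getD i false = false := List.getD_eq_default _ _ (by rw [hl]; omega)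
    simp only [this, Bool.false_eq_true]

theorem adds_xorEquiv {l : ℕ} (s : Fin l → Bool) {ρ : X → Fin l → Bool} {i : Fin l}
    (hρ : Adds enc 0 F {fun z => ρ z i = true}) :
    Adds enc 1 F {fun z => xorEquiv s (ρ z) i = true} := by
  cases h : s i
  · simpa [xorEquiv, h] using hρ.mono_cost (Nat.zero_le 1)
  · simpa [xorEquiv, h] using hρ.not

/-- Once the length of the solution is known, removing the padding means reading fixed output wires.
An adversary can thus imitate it without searching for the marker. -/
theorem unpad_eq_drop {o : List Bool} {W : ℕ} (h : (unpad o).length = W) :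
    unpad o = o.drop (o.length - W) := by
  have : unpad o <:+ o := (List.tail_suffix _).trans (List.dropWhile_suffix _)
  rw [List.suffix_iff_eq_drop] at this
  rwa [h] at this

end Encoding

section Inputs

variable {X : Type} {m : ℕ}

/-- The predicates that are computed by input wires. -/
def inputPreds (enc : X → List.Vector Bool m) : Set (X → Prop) :=
  {p | ∃ i < m, ∀ z, (enc z).toList.getD i false = true ↔ p z}

variable {enc : X → List.Vector Bool m}

theorem adds_input_of_lt {i : ℕ} (hi : i < m) :
    Adds enc 0 (inputPreds enc) {fun z => (enc z).toList.getD i false = true} :=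
  Adds.of_subset (Set.singleton_subset_iff.2 ⟨i, hi, fun _ => Iff.rfl⟩)

theorem adds_input (i : ℕ) :
    Adds enc 1 (inputPreds enc) {fun z => (enc z).toList.getD i false = true} := by
  by_cases hi : i < m
  · exact (adds_input_of_lt hi).mono_cost (Nat.zero_le 1)
  · convert Adds.const False using 3 with z
    rw [List.getD_eq_default _ _ (by simpa using hi)]
    simp

end Inputs

/-! ### The search problem for one network: verification, totality, hardness -/

namespace LocalAlgorithm

variable {Ψ : LCL} (A : LocalAlgorithm Ψ)

/-- The length of a solution of the search problem on graphs with `n` nodes. -/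
def witnessLen (Ψ : LCL) (n : ℕ) : ℕ := labelLen n Ψ.vIn Ψ.eIn

/-- The number of groups of samples of the private coins. -/
def groups (n : ℕ) : ℕ := A.pubLen n + witnessLen Ψ n + 2

/-- The size of each group of samples. -/
def groupSize (d n : ℕ) : ℕ := 2 * d * (2 * (A.pubLen n + witnessLen Ψ n) + 4)

/-- The number of shifts of the public coins. -/
def shifts (d n : ℕ) : ℕ := 2 * d * (A.pubLen n + 1)

section Refutes

variable {A} {c n t g : ℕ} (N : Network Ψ.maxDeg c n) (r : ℕ)

/-- In each group of samples of the private coins, there is one for which the algorithm fails. -/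
def Refutes (σ : Fin t → Fin g → A.PrivCoins n) (ρ : A.PubCoins n)
    (x : Labeling N.graph Ψ.vIn Ψ.eIn) : Prop :=
  ∀ a, ∃ b, ¬ A.Succeeds r N x ρ (σ a b)

/-- The search problem on graphs with `n` nodes: find a labeling that, for one of the shifts of
the public coins, refutes the success of the algorithm. -/
def FailureRel {k : ℕ} (x₀ : Labeling N.graph Ψ.vIn Ψ.eIn)
    (σ : Fin t → Fin g → A.PrivCoins n) (s : Fin k → A.PubCoins n) (x w : List Bool) : Prop :=
  w.length = witnessLen Ψ n ∧
    ∃ j, Refutes N r σ (xorEquiv (s j) fun i => x.getD i false) (decodeLabeling x₀ w)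

variable (A) in
/-- The size of the circuits that verify solutions. -/
noncomputable def verifyCost (M d n : ℕ) : ℕ :=
  witnessLen Ψ n * determinedCost (Ψ.vIn + Ψ.eIn) 1 + (A.shifts d n * (A.groups n *
    (A.groupSize d n * (A.succeedsCost M n + 1 + 1) + 1 + 1) + 1 + 1) + 1)

variable {N r}

/-- The labeling is decoded once; then the algorithm is simulated for all shifts and samples, which
are hard-wired. -/
theorem exists_verifier {M d : ℕ} (hM : ∀ H ∈ Ψ.allowed, H.size ≤ M)
    (x₀ : Labeling N.graph Ψ.vIn Ψ.eIn)
    (σ : Fin (A.groups n) → Fin (A.groupSize d n) → A.PrivCoins n)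
    (s : Fin (A.shifts d n) → A.PubCoins n) {l : ℕ} (hl : A.pubLen n ≤ l) :
    ∃ C : Circuit, C.size ≤ A.verifyCost M d n + 1 ∧ ∀ x w : List Bool, x.length = l →
      w.length = witnessLen Ψ n → (C.eval (x ++ w) = [true] ↔ FailureRel N r x₀ σ s x w) := by
  let X := {z : List Bool × List Bool // z.1.length = l ∧ z.2.length = witnessLen Ψ n}
  let enc : X → List.Vector Bool (l + witnessLen Ψ n) := fun z =>
    ⟨z.1.1 ++ z.1.2, by rw [List.length_append, z.2.1, z.2.2]⟩
  have hx : ∀ i < l, Adds enc 0 (inputPreds enc) {fun z => z.1.1.getD i false = true} := by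
    intro i hi
    convert adds_input_of_lt (enc := enc) (i := i) (by omega) using 4 with z
    exact (List.getD_append _ _ _ _ (by rwa [z.2.1])).symm
  have hw : ∀ i, Adds enc 1 (inputPreds enc) {fun z => z.1.2.getD i false = true} := by
    intro i
    convert adds_input (enc := enc) (l + i) using 4 with z
    change _ = (z.1.1 ++ z.1.2).getD (l + i) false
    rw [List.getD_append_right _ _ _ _ (by rw [z.2.1]; omega), z.2.1, Nat.add_sub_cancel_left]
  have key : Adds enc (A.verifyCost M d n) (inputPreds enc)
      {fun z => FailureRel N r x₀ σ s z.1.1 z.1.2} := by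
    have h := (adds_decodeLabeling x₀ hw).trans_union (Adds.exists_fintype fun j =>
      Adds.forall_fintype fun a => Adds.exists_fintype fun b =>
        (adds_succeeds N (fun z => decodeLabeling x₀ z.1.2)
          (fun z => xorEquiv (s j) fun i => z.1.1.getD i false) (σ a b) Set.subset_union_right
          (fun i => adds_xorEquiv (s j) ((hx i (i.2.trans_le hl)).mono Set.subset_union_left
            le_rfl subset_rfl)) hM r).not)
    simp only [Fintype.card_fin] at h
    refine h.mono subset_rfl (Eq.le ?_) ?_
    · simp only [verifyCost, witnessLen]
    rw [Set.singleton_subset_singleton]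
    funext z
    simp only [FailureRel, z.2.2, true_and, Refutes]
  obtain ⟨gs, hgs, h⟩ := key.exists_gates fun f hf => hf
  obtain ⟨i, -, hi⟩ := h _ rfl
  refine ⟨⟨gs, [i]⟩, by simpa [Circuit.size] using hgs, fun x w hx hw => ?_⟩
  refine Iff.trans ?_ (hi ⟨(x, w), hx, hw⟩)
  simp [Circuit.eval, enc]

variable (Ψ) in
/-- The cost of the decoding of a labeling by an adversary. -/
def decodeCost (n : ℕ) : ℕ := witnessLen Ψ n * determinedCost (Ψ.vIn + Ψ.eIn) 1

/-- The last `W` output bits of a circuit. -/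
def lastBits (W : ℕ) (C : Circuit) (x : List Bool) : List Bool :=
  (C.eval x).drop (C.outs.length - W)

/-- The adversary shifts the public coins, pads them with `l'` coins of its own to the instance
length, and runs the solver. The string appears twice because with the identity sampler the instance
equals the sampler's coins. -/
theorem exists_adversary (x₀ : Labeling N.graph Ψ.vIn Ψ.eIn) (s : A.PubCoins n) {l' : ℕ}
    (Sol : RandCircuit) :
    ∃ B : BoundedAdversary N.graph Ψ.vIn Ψ.eIn (A.pubLen n),
      ∃ e : (Fin l' → Bool) × (Fin Sol.coins → Bool) ≃ (Fin B.coins → Bool),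
        B.size ≤ 4 * (A.pubLen n + l' + Sol.size) + 1 + decodeCost Ψ n ∧
        ∀ ρ κ, B.choose ρ (e κ) = decodeLabeling x₀ (lastBits (witnessLen Ψ n) Sol.circuit
          (List.ofFn (Fin.append (xorEquiv s ρ) κ.1) ++
            List.ofFn (Fin.append (xorEquiv s ρ) κ.1) ++ List.ofFn κ.2)) := by
  let e := Fin.appendEquiv (α := Bool) l' Sol.coins
  let X := A.PubCoins n × (Fin (l' + Sol.coins) → Bool)
  let enc : X → List.Vector Bool (A.pubLen n + (l' + Sol.coins)) := fun z =>
    ⟨List.ofFn z.1 ++ List.ofFn z.2, by simp⟩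
  let inp : X → List Bool := fun z => List.ofFn (Fin.append (xorEquiv s z.1) (e.symm z.2).1) ++
    List.ofFn (Fin.append (xorEquiv s z.1) (e.symm z.2).1) ++ List.ofFn (e.symm z.2).2
  have h1 : ∀ i, Adds enc 0 (inputPreds enc) {fun z => z.1 i = true} := by
    intro i
    convert adds_input_of_lt (enc := enc) (i := i) (by omega) using 4 with z
    change _ = (List.ofFn z.1 ++ List.ofFn z.2).getD i false
    rw [List.getD_append _ _ _ _ (by simp)]
    simp [List.getD_eq_getElem?_getD]
  have h2 : ∀ i, Adds enc 1 (inputPreds enc) {fun z => z.2 i = true} := by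
    intro i
    convert adds_input (enc := enc) (A.pubLen n + i) using 4 with z
    change _ = (List.ofFn z.1 ++ List.ofFn z.2).getD (A.pubLen n + i) false
    rw [List.getD_append_right _ _ _ _ (by simp)]
    simp [List.getD_eq_getElem?_getD]
  have hr : ∀ i, Adds enc 1 (inputPreds enc) {fun z =>
      (List.ofFn (Fin.append (xorEquiv s z.1) (e.symm z.2).1)).getD i false = true} := by
    simp only [List.ofFn_fin_append]
    exact adds_getD_append (l := A.pubLen n) (by simp) (adds_getD_ofFn fun i => adds_xorEquiv s (h1 i))
      (adds_getD_ofFn fun i => h2 _)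
  have hinp : ∀ i, Adds enc 1 (inputPreds enc) {fun z => (inp z).getD i false = true} :=
    adds_getD_append (l := (A.pubLen n + l') + (A.pubLen n + l'))
      (fun z => by rw [List.length_append, List.length_ofFn])
      (adds_getD_append (l := A.pubLen n + l') (fun z => List.length_ofFn) hr hr) (adds_getD_ofFn fun i => h2 _)
  have hlen : ∀ z, (inp z).length =
      (A.pubLen n + l') + (A.pubLen n + l') + Sol.coins := fun z => by
    simp only [inp, List.length_append, List.length_ofFn]
  have hW := (adds_getD_range hlen hinp).trans
    (Adds.of_wires Sol.circuit.gates inp hlen fun i => Adds.of_subset (by simp))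
  have hout : ∀ i, Adds enc 1 (Set.range fun i z =>
      (wires Sol.circuit.gates (inp z)).getD i false = true)
      {fun z => (lastBits (witnessLen Ψ n) Sol.circuit (inp z)).getD i false = true} := by
    intro i
    simp only [lastBits, Circuit.eval, List.getD_eq_getElem?_getD, List.getElem?_drop,
      List.getElem?_map]
    cases Sol.circuit.outs[Sol.circuit.outs.length - witnessLen Ψ n + i]? with
    | none => simpa using Adds.const False
    | some k => exact Adds.of_subset (by simp)
  obtain ⟨gs, hgs, hcomp⟩ := (hW.trans (adds_decodeLabeling x₀ hout)).exists_gates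
    fun f hf => hf
  choose nw _ hnw using fun i : Fin n × Fin Ψ.vIn => hcomp _ (.inl ⟨i, rfl⟩)
  choose hw _ hhw using fun i : N.graph.Dart × Fin Ψ.eIn => hcomp _ (.inr ⟨i, rfl⟩)
  refine ⟨⟨l' + Sol.coins, gs, fun v i => nw (v, i), fun v i => hw (v, i), fun ρ κ =>
    decodeLabeling x₀ (lastBits (witnessLen Ψ n) Sol.circuit (inp (ρ, κ))),
    fun ρ κ v i => hnw (v, i) (ρ, κ), fun ρ κ v i => hhw (v, i) (ρ, κ)⟩, e, ?_, fun ρ κ => ?_⟩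
  · simp only [BoundedAdversary.size, RandCircuit.size, Circuit.size, decodeCost, witnessLen]
      at hgs ⊢
    omega
  · simp only [inp, Equiv.symm_apply_apply]

/-- Each winning answer refutes the algorithm at some shift `j`. For fixed `j` the adversary built
from the solver produces the same refutation with the same probability, and each one forces failure
with probability at least `τ`. -/
theorem prob_solves_le {k : ℕ} {τ δ : ℝ} (hτ : 0 < τ) (x₀ : Labeling N.graph Ψ.vIn Ψ.eIn)
    {σ : Fin t → Fin g → A.PrivCoins n} {s : Fin k → A.PubCoins n}
    (hσ : ∀ ρ x, Refutes N r σ ρ x → τ ≤ prob fun κ => ¬ A.Succeeds r N x ρ κ) {l : ℕ}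
    (hl : A.pubLen n ≤ l) (Sol : RandCircuit)
    (hA : ∀ B : BoundedAdversary N.graph Ψ.vIn Ψ.eIn (A.pubLen n),
      B.size ≤ 4 * (l + Sol.size) + 1 + decodeCost Ψ n →
      1 - δ ≤ prob fun ω : (Fin B.coins → Bool) × A.PubCoins n × A.PrivCoins n =>
        A.Succeeds r N (B.choose ω.2.1 ω.1) ω.2.1 ω.2.2) :
    (prob fun ω : (Fin l → Bool) × (Fin Sol.coins → Bool) =>
      FailureRel N r x₀ σ s (List.ofFn ω.1)
        (unpad (Sol.circuit.eval (List.ofFn ω.1 ++ List.ofFn ω.1 ++ List.ofFn ω.2)))) ≤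
      k * (δ / τ) := by
  obtain ⟨l', rfl⟩ := Nat.exists_eq_add_of_le hl
  set W := witnessLen Ψ n
  let out : (Fin (A.pubLen n + l') → Bool) × (Fin Sol.coins → Bool) →
      Labeling N.graph Ψ.vIn Ψ.eIn := fun ω => decodeLabeling x₀ (lastBits W Sol.circuit
        (List.ofFn ω.1 ++ List.ofFn ω.1 ++ List.ofFn ω.2))
  have hj : ∀ j, (prob fun ω : (Fin (A.pubLen n + l') → Bool) × (Fin Sol.coins → Bool) =>
      Refutes N r σ (xorEquiv (s j) fun i => ω.1 (Fin.castAdd l' i)) (out ω)) ≤ δ / τ := by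
    intro j
    obtain ⟨B, e, hB, hchoose⟩ := exists_adversary (N := N) x₀ (s j) (l' := l') Sol
    rw [le_div_iff₀ hτ]
    -- The bijection from the experiment of the adversary to that of the solver. Since the shift is
    -- an involution, shifting the solver's instance gives back the adversary's public coins.
    let Φ : (Fin B.coins → Bool) × A.PubCoins n ≃
        (Fin (A.pubLen n + l') → Bool) × (Fin Sol.coins → Bool) :=
      ((Equiv.prodCongr e.symm (xorEquiv (s j))).trans (Equiv.prodComm _ _)).trans
        ((Equiv.prodAssoc _ _ _).symm.trans
          (Equiv.prodCongr (Fin.appendEquiv (α := Bool) (A.pubLen n) l') (Equiv.refl _)))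
    rw [← prob_equiv Φ]
    have hΦ : ∀ ω, Refutes N r σ (xorEquiv (s j) fun i => (Φ ω).1 (Fin.castAdd l' i))
        (out (Φ ω)) ↔ Refutes N r σ ω.2 (B.choose ω.2 ω.1) := by
      rintro ⟨κ, ρ⟩
      obtain ⟨κ, rfl⟩ := e.surjective κ
      have hΦ : Φ (e κ, ρ) = (Fin.append (xorEquiv (s j) ρ) κ.1, κ.2) := by
        change (Fin.append (xorEquiv (s j) ρ) (e.symm (e κ)).1, (e.symm (e κ)).2) = _
        rw [e.symm_apply_apply]
      have h1 : (xorEquiv (s j) fun i => (Φ (e κ, ρ)).1 (Fin.castAdd l' i)) = ρ := by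
        rw [hΦ]
        funext i
        simp [xorEquiv]
      have h2 : out (Φ (e κ, ρ)) = B.choose ρ (e κ) := by
        rw [hchoose, hΦ]
      rw [h1, h2]
    simp only [hΦ]
    have h0 := mul_prob_le_prob_prod
      (fun (ω : (Fin B.coins → Bool) × A.PubCoins n) (κ : A.PrivCoins n) =>
        ¬ A.Succeeds r N (B.choose ω.2 ω.1) ω.2 κ)
      (Q := fun ω => Refutes N r σ ω.2 (B.choose ω.2 ω.1))
      fun ω hω => hσ ω.2 (B.choose ω.2 ω.1) hω
    refine h0.trans ?_
    have h1 := hA B hB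
    have h2 := prob_not fun ω : (Fin B.coins → Bool) × A.PubCoins n × A.PrivCoins n =>
        A.Succeeds r N (B.choose ω.2.1 ω.1) ω.2.1 ω.2.2
    have h3 := prob_equiv (Equiv.prodAssoc (Fin B.coins → Bool) (A.PubCoins n) (A.PrivCoins n))
      fun ω => ¬ A.Succeeds r N (B.choose ω.2.1 ω.1) ω.2.1 ω.2.2
    refine h3.le.trans ?_
    rw [h2]
    linarith
  have hsub : ∀ ω : (Fin (A.pubLen n + l') → Bool) × (Fin Sol.coins → Bool),
      FailureRel N r x₀ σ s (List.ofFn ω.1)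
        (unpad (Sol.circuit.eval (List.ofFn ω.1 ++ List.ofFn ω.1 ++ List.ofFn ω.2))) →
      ∃ j, Refutes N r σ (xorEquiv (s j) fun i => ω.1 (Fin.castAdd l' i)) (out ω) := by
    rintro ω ⟨h1, j, h2⟩
    refine ⟨j, ?_⟩
    rw [unpad_eq_drop h1] at h2
    have h3 : (fun i : Fin (A.pubLen n) => (List.ofFn ω.1).getD i false) =
        fun i => ω.1 (Fin.castAdd l' i) := by
      funext i
      have := i.2
      rw [List.getD_eq_getElem _ _ (by simp; omega)]
      simp [Fin.castAdd, Fin.castLE]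
    rw [h3] at h2
    simpa only [out, lastBits, Circuit.eval, List.length_map] using h2
  calc _ ≤ _ := prob_mono hsub
    _ ≤ _ := prob_exists_le _
    _ ≤ ∑ _j : Fin k, δ / τ := Finset.sum_le_sum fun j _ => hj j
    _ = k * (δ / τ) := by simp

end Refutes

variable {A}

/-- From an adversary against which the algorithm fails with noticeable probability, one gets a
total search problem whose solutions are efficiently verifiable, and a solver of which is an
efficient adversary. -/
theorem exists_hard_relation {M c d n r : ℕ} (hM : ∀ H ∈ Ψ.allowed, H.size ≤ M)
    (N : Network Ψ.maxDeg c n) (hd : 1 ≤ d) (B : A.PubCoins n → Labeling N.graph Ψ.vIn Ψ.eIn)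
    (hB : (prob fun ω : A.PubCoins n × A.PrivCoins n => A.Succeeds r N (B ω.1) ω.1 ω.2) ≤
      1 - 1 / d) :
    ∃ R : SearchProblem, (∀ x w, R x w → w.length = witnessLen Ψ n) ∧ (∀ x, ∃ w, R x w) ∧
      (∀ l, A.pubLen n ≤ l → ∃ C : Circuit, C.size ≤ A.verifyCost M d n + 1 ∧
        ∀ x w : List Bool, x.length = l → w.length = witnessLen Ψ n →
          (C.eval (x ++ w) = [true] ↔ R x w)) ∧
      ∀ l, A.pubLen n ≤ l → ∀ (Sol : RandCircuit) (δ : ℝ),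
        (∀ B : BoundedAdversary N.graph Ψ.vIn Ψ.eIn (A.pubLen n),
          B.size ≤ 4 * (l + Sol.size) + 1 + decodeCost Ψ n →
          1 - δ ≤ prob fun ω : (Fin B.coins → Bool) × A.PubCoins n × A.PrivCoins n =>
            A.Succeeds r N (B.choose ω.2.1 ω.1) ω.2.1 ω.2.2) →
        (prob fun ω : (Fin l → Bool) × (Fin Sol.coins → Bool) => R (List.ofFn ω.1)
          (unpad (Sol.circuit.eval (List.ofFn ω.1 ++ List.ofFn ω.1 ++ List.ofFn ω.2)))) ≤
          (A.shifts d n * (2 * A.groupSize d n) : ℕ) * δ := by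
  -- A default for decoding has to come from somewhere, as label sets may be empty; the given
  -- adversary supplies one.
  let x₀ := B fun _ => false
  obtain ⟨_, hcard⟩ := exists_fintype_labeling x₀
  have hfail := prob_not fun ω : A.PubCoins n × A.PrivCoins n => A.Succeeds r N (B ω.1) ω.1 ω.2
  obtain ⟨σ, s, h1, h2⟩ := exists_samples_and_shifts (M := witnessLen Ψ n)
    (fun ρ x (κ : A.PrivCoins n) => ¬ A.Succeeds r N x ρ κ) hcard hd B (by
      rw [hfail]; linarith)
  refine ⟨FailureRel N r x₀ σ s, fun x w h => h.1, fun x => ?_,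
    fun l hl => exists_verifier hM x₀ σ s hl, fun l hl Sol δ hA => ?_⟩
  · obtain ⟨j, y, hy⟩ := h1 fun i => x.getD i false
    obtain ⟨w, hw⟩ := exists_decodeLabeling_eq x₀ y
    refine ⟨List.ofFn w, by simp [witnessLen], j, ?_⟩
    rw [hw]
    exact hy
  · have hg : 0 < (2 * d * (2 * (A.pubLen n + witnessLen Ψ n) + 4)) := by positivity
    have hg' : (0 : ℝ) < (2 * d * (2 * (A.pubLen n + witnessLen Ψ n) + 4) : ℕ) := by
      exact_mod_cast hg
    refine (prob_solves_le (by positivity) x₀ h2 hl Sol hA).trans_eq ?_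
    rw [shifts, groupSize]
    push_cast
    field_simp

end LocalAlgorithm

/-! ## Polynomial bounds -/

section PolyBounds

/-- `f` is bounded by a polynomial. -/
def PolyBounded (f : ℕ → ℕ) : Prop := ∃ q : Polynomial ℕ, ∀ n, f n ≤ q.eval n

namespace PolyBounded

variable {f g : ℕ → ℕ}

theorem eval (q : Polynomial ℕ) : PolyBounded fun n => q.eval n := ⟨q, fun _ => le_rfl⟩

theorem const (k : ℕ) : PolyBounded fun _ => k := ⟨.C k, by simp⟩

theorem id : PolyBounded fun n => n := ⟨.X, by simp⟩

theorem add (hf : PolyBounded f) (hg : PolyBounded g) : PolyBounded fun n => f n + g n := by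
  obtain ⟨p, hp⟩ := hf
  obtain ⟨q, hq⟩ := hg
  exact ⟨p + q, fun n => by rw [Polynomial.eval_add]; exact add_le_add (hp n) (hq n)⟩

theorem mul (hf : PolyBounded f) (hg : PolyBounded g) : PolyBounded fun n => f n * g n := by
  obtain ⟨p, hp⟩ := hf
  obtain ⟨q, hq⟩ := hg
  exact ⟨p * q, fun n => by rw [Polynomial.eval_mul]; exact Nat.mul_le_mul (hp n) (hq n)⟩

theorem pow (hf : PolyBounded f) (k : ℕ) : PolyBounded fun n => f n ^ k := by
  obtain ⟨p, hp⟩ := hf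
  exact ⟨p ^ k, fun n => by rw [Polynomial.eval_pow]; exact Nat.pow_le_pow_left (hp n) k⟩

theorem determinedCost (d : ℕ) (hf : PolyBounded f) :
    PolyBounded fun n => determinedCost d (f n) :=
  (((const (2 ^ d)).mul (((const d).mul (hf.add (const 2))).add (const 3))).add (const 1))

end PolyBounded

theorem Polynomial.eval_mono_nat (q : Polynomial ℕ) : Monotone fun n : ℕ => q.eval n := by
  intro a b h
  simp only [Polynomial.eval_eq_sum, Polynomial.sum_def]
  gcongr

theorem Polynomial.exists_nat_bound (p : Polynomial ℝ) :
    ∃ q : Polynomial ℕ, ∀ n : ℕ, p.eval (n : ℝ) ≤ q.eval n := by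
  induction p using Polynomial.induction_on' with
  | add p q hp hq =>
    obtain ⟨p', hp⟩ := hp
    obtain ⟨q', hq⟩ := hq
    refine ⟨p' + q', fun n => ?_⟩
    rw [Polynomial.eval_add, Polynomial.eval_add]
    push_cast
    exact add_le_add (hp n) (hq n)
  | monomial k a =>
    refine ⟨Polynomial.monomial k ⌈a⌉₊, fun n => ?_⟩
    rw [Polynomial.eval_monomial, Polynomial.eval_monomial]
    push_cast
    gcongr
    exact Nat.le_ceil a

namespace LocalAlgorithm

variable {Ψ : LCL} (A : LocalAlgorithm Ψ)

theorem polyBounded_pubLen : PolyBounded A.pubLen := ⟨A.time, A.pubLen_le⟩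

theorem polyBounded_nodeCount : PolyBounded fun n => A.nodeCount (A.headBound n) := by
  have hP : PolyBounded A.headBound :=
    ((PolyBounded.eval A.time).add (.const 1)).mul (.eval A.time)
  exact ((PolyBounded.const _).add ((PolyBounded.const _).mul (hP.add (.const 1)))).add
    ((PolyBounded.const _).mul ((hP.add (.const 1)).mul (.const _)))

theorem polyBounded_stepCost : PolyBounded fun n => A.stepCost (A.headBound n) := by
  have hP : PolyBounded A.headBound :=
    ((PolyBounded.eval A.time).add (.const 1)).mul (.eval A.time)
  exact (((PolyBounded.const 2).mul hP).add (.const 3)).determinedCost _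

theorem polyBounded_runCost : PolyBounded A.runCost :=
  (PolyBounded.id.mul (A.polyBounded_nodeCount.mul (.const _))).add
    (((PolyBounded.eval A.time).add (.const 1)).mul
      ((PolyBounded.id.mul ((PolyBounded.eval A.time).mul
        (A.polyBounded_nodeCount.mul A.polyBounded_stepCost))).add
        (PolyBounded.id.mul (A.polyBounded_nodeCount.mul (.const _)))))

theorem polyBounded_succeedsCost (M : ℕ) : PolyBounded fun n => A.succeedsCost M n :=
  A.polyBounded_runCost.add ((((PolyBounded.id.add (PolyBounded.id.mul .id)).mul (.const _)).add
    (.const 5)).add (PolyBounded.id.mul ((((PolyBounded.const _).mul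
      ((((PolyBounded.id.add (.const 1)).pow M).mul (.const _)).add (.const 2))).add
        (.const 1)).add (.const 1))))

theorem polyBounded_witnessLen : PolyBounded fun n => witnessLen Ψ n :=
  (PolyBounded.id.mul (.const _)).add ((PolyBounded.id.mul .id).mul (.const _))

theorem polyBounded_decodeCost : PolyBounded fun n => decodeCost Ψ n :=
  polyBounded_witnessLen.mul (.const _)

variable {d : ℕ → ℕ}

theorem polyBounded_groupSize (hd : PolyBounded d) : PolyBounded fun n => A.groupSize (d n) n :=
  ((PolyBounded.const 2).mul hd).mul
    (((PolyBounded.const 2).mul (A.polyBounded_pubLen.add polyBounded_witnessLen)).add (.const 4))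

theorem polyBounded_shifts (hd : PolyBounded d) : PolyBounded fun n => A.shifts (d n) n :=
  ((PolyBounded.const 2).mul hd).mul (A.polyBounded_pubLen.add (.const 1))

theorem polyBounded_verifyCost (hd : PolyBounded d) (M : ℕ) :
    PolyBounded fun n => A.verifyCost M (d n) n :=
  (polyBounded_witnessLen.mul (.const _)).add (((A.polyBounded_shifts hd).mul
    ((((A.polyBounded_pubLen.add polyBounded_witnessLen).add (.const 2)).mul
      ((((A.polyBounded_groupSize hd).mul
        (((A.polyBounded_succeedsCost M).add (.const 1)).add (.const 1))).add (.const 1)).add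
          (.const 1))).add (.const 1) |>.add (.const 1))).add (.const 1))

end LocalAlgorithm

end PolyBounds

/-! ## Negligible functions -/

section Negligible

theorem Negligible.polynomial_mul {ε : ℕ → ℝ} (hε : Negligible ε) (q : Polynomial ℕ) :
    Negligible fun n => ((q.eval n : ℕ) : ℝ) * ε n := by
  have := Asymptotics.SuperpolynomialDecay.polynomial_mul hε (q.map (Nat.castRingHom ℝ))
  refine this.congr fun n => ?_
  simp

theorem negligible_half_pow : Negligible fun n => (1 / 2 : ℝ) ^ n :=
  fun k => tendsto_pow_const_mul_const_pow_of_lt_one k (by norm_num) (by norm_num)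

/-- A negligible function stays negligible after a polynomial change of the parameter. -/
theorem Negligible.extend {ε : ℕ → ℝ} (hε : Negligible ε) (q : Polynomial ℕ)
    (hq : StrictMono fun n : ℕ => q.eval n) :
    Negligible (Function.extend (fun n : ℕ => q.eval n) ε 0) := by
  intro k
  have h : Tendsto (fun n => ((q.eval n : ℕ) : ℝ) ^ k * ε n) atTop (nhds 0) := by
    have := hε.polynomial_mul (q ^ k) 0
    simpa using this
  rw [Metric.tendsto_atTop] at h ⊢
  intro e he
  obtain ⟨n₀, hn₀⟩ := h e he
  refine ⟨q.eval n₀, fun l hl => ?_⟩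
  by_cases hr : ∃ n, q.eval n = l
  · obtain ⟨n, rfl⟩ := hr
    have := hq.injective.extend_apply ε 0 n
    rw [this]
    exact hn₀ n (hq.le_iff_le.1 hl)
  · rw [Function.extend_apply' _ _ _ hr]
    simpa using he

end Negligible

/-! ## The search problem -/

theorem exists_const_circuit (a : ℕ) (b : Bool) : ∃ C : Circuit, C.size = 2 ∧
    ∀ x : List Bool, x.length = a → C.eval x = [b] := by
  refine ⟨⟨[.const b], [a]⟩, rfl, fun x hx => ?_⟩
  simp [Circuit.eval, wires, Gate.eval, ← hx]

/-- Search problems for infinitely many instance lengths are combined to one. -/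
theorem exists_search_problem {Bad : ℕ → Prop} {W : ℕ → ℕ} (hW : PolyBounded W)
    (R : ∀ n, Bad n → SearchProblem) (hlen : ∀ n hn x w, R n hn x w → w.length = W n)
    (htotal : ∀ n hn x, ∃ w, R n hn x w) {V : ℕ → ℕ} (hV : PolyBounded V)
    {L : ℕ → ℕ} (hL : StrictMono L)
    (hver : ∀ n hn, ∃ C : Circuit, C.size ≤ V n ∧ ∀ x w : List Bool, x.length = L n →
      w.length = W n → (C.eval (x ++ w) = [true] ↔ R n hn x w)) :
    ∃ S : SearchProblem, S.InTFNPpoly ∧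
      ∀ n hn x w, x.length = L n → (S x w ↔ R n hn x w) := by
  have hle : ∀ n, n ≤ L n := fun n => hL.le_apply
  -- As `L` is injective, the length of an instance determines the network used. At all other
  -- lengths the empty string is the only solution, which keeps the problem total and its
  -- verification trivial.
  let S : SearchProblem := fun x w => (∃ n hn, x.length = L n ∧ R n hn x w) ∨
    (¬ ∃ n, Bad n ∧ x.length = L n) ∧ w = []
  have hS : ∀ n hn x w, x.length = L n → (S x w ↔ R n hn x w) := by
    intro n hn x w hx
    constructor
    · rintro (⟨n', hn', hx', h⟩ | ⟨h, -⟩)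
      · obtain rfl := hL.injective (hx.symm.trans hx')
        exact h
      · exact (h ⟨n, hn, hx⟩).elim
    · exact fun h => .inl ⟨n, hn, hx, h⟩
  have hS' : ∀ x w : List Bool, (¬ ∃ n, Bad n ∧ x.length = L n) → (S x w ↔ w = []) := by
    intro x w hx
    constructor
    · rintro (⟨n, hn, h, -⟩ | ⟨-, h⟩)
      · exact (hx ⟨n, hn, h⟩).elim
      · exact h
    · exact fun h => .inr ⟨hx, h⟩
  refine ⟨S, ⟨?_, ?_, fun x => ?_⟩, hS⟩
  · obtain ⟨q, hq⟩ := hW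
    refine ⟨q, ?_⟩
    rintro x w (⟨n, hn, hx, h⟩ | ⟨-, rfl⟩)
    · rw [hlen n hn x w h, hx]
      exact (hq n).trans (q.eval_mono_nat (hle n))
    · simp
  · obtain ⟨q, hq⟩ := hV
    refine ⟨q + 2, fun a b => ?_⟩
    have h2 : 2 ≤ (q + 2).eval (a + b) := by simp
    by_cases ha : ∃ n, Bad n ∧ a = L n
    · obtain ⟨n, hn, rfl⟩ := ha
      by_cases hb : b = W n
      · subst hb
        obtain ⟨C, hC, h⟩ := hver n hn
        refine ⟨C, ?_, fun x w hx hw => (h x w hx hw).trans (hS n hn x w hx).symm⟩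
        calc C.size ≤ q.eval n := hC.trans (hq n)
          _ ≤ q.eval (L n + W n) := q.eval_mono_nat ((hle n).trans (Nat.le_add_right _ _))
          _ ≤ _ := by simp
      · obtain ⟨C, hC, h⟩ := exists_const_circuit (L n + b) false
        refine ⟨C, hC.le.trans h2, fun x w hx hw => ?_⟩
        rw [h _ (by rw [List.length_append, hx, hw]), hS n hn x w hx]
        simpa using fun hR => hb (hw ▸ hlen n hn x w hR)
    · by_cases hb : b = 0
      · obtain ⟨C, hC, h⟩ := exists_const_circuit (a + b) true
        refine ⟨C, hC.le.trans h2, fun x w hx hw => ?_⟩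
        rw [h _ (by rw [List.length_append, hx, hw]), hS' x w (by rwa [hx])]
        simpa using List.length_eq_zero_iff.1 (hw.trans hb)
      · obtain ⟨C, hC, h⟩ := exists_const_circuit (a + b) false
        refine ⟨C, hC.le.trans h2, fun x w hx hw => ?_⟩
        rw [h _ (by rw [List.length_append, hx, hw]), hS' x w (by rwa [hx])]
        simp only [List.cons.injEq, Bool.false_eq_true, and_true, false_iff]
        rintro rfl
        exact hb hw.symm
  · by_cases hx : ∃ n, Bad n ∧ x.length = L n
    · obtain ⟨n, hn, hx⟩ := hx
      obtain ⟨w, hw⟩ := htotal n hn x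
      exact ⟨w, (hS n hn x w hx).2 hw⟩
    · exact ⟨[], (hS' x [] hx).2 rfl⟩

theorem isSampler_id : IsSampler id := ⟨fun _ => rfl, ⟨Turing.idComputableInPolyTime id⟩⟩

theorem theorem2 (Ψ : LCL) (c : ℕ) (hc : 1 ≤ c)
    (ε : ℕ → ℝ) (hε : Negligible ε)
    (p : Polynomial ℝ) (hp : ∀ᶠ n : ℕ in atTop, 0 < p.eval (n : ℝ))
    (hgap : RoundGap c Ψ ε (fun n => 1 / p.eval (n : ℝ))) :
    ∃ (S : SearchProblem) (D : List Bool → List Bool),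
      S.InTFNPpoly ∧ IsSampler D ∧ PublicCoinInfOftenPolyHard S D := by
  obtain ⟨r, ⟨A, hA⟩, hU⟩ := hgap
  obtain ⟨M, hM⟩ := Ψ.exists_size_le
  obtain ⟨q, hq⟩ := p.exists_nat_bound
  -- A positive natural upper bound of `p`, so that an error above 1/p is an error above 1/d.
  let d : ℕ → ℕ := fun n => q.eval n + 1
  have hd : PolyBounded d := (PolyBounded.eval q).add (.const 1)
  let Bad : ℕ → Prop := fun n => ∃ (N : Network Ψ.maxDeg c n)
    (B : A.PubCoins n → Labeling N.graph Ψ.vIn Ψ.eIn),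
    (prob fun ω : A.PubCoins n × A.PrivCoins n => A.Succeeds (r n) N (B ω.1) ω.1 ω.2) ≤
      1 - 1 / d n
  have hbad : ∃ᶠ n in atTop, Bad n := by
    have h : ¬ SolvesUnbounded c Ψ (fun n => 1 / p.eval (n : ℝ)) r A := fun h => hU ⟨A, h⟩
    refine ((not_eventually.1 h).and_eventually hp).mono fun n ⟨h, hpn⟩ => ?_
    push Not at h
    obtain ⟨N, B, h⟩ := h
    refine ⟨N, B, h.le.trans ?_⟩
    have := hq n
    gcongr
    simp only [d]
    push_cast
    linarith
  choose N B hB using fun n (hn : Bad n) => hn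
  choose R hlen htotal hver hhard using fun n (hn : Bad n) =>
    A.exists_hard_relation hM (N n hn) (Nat.le_add_left 1 (q.eval n)) (B n hn) (hB n hn)
  -- The first summand leaves room for the public coins; the second makes instance lengths strictly
  -- increasing in the graph size.
  let Lp : Polynomial ℕ := A.time + .X
  have hLp : StrictMono fun n : ℕ => Lp.eval n := by
    intro a b hab
    have := A.time.eval_mono_nat hab.le
    simp only [Lp, Polynomial.eval_add, Polynomial.eval_X] at this ⊢
    omega
  have hpub : ∀ n, A.pubLen n ≤ Lp.eval n := fun n => by
    have := A.pubLen_le n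
    simp only [Lp, Polynomial.eval_add]
    omega
  obtain ⟨S, hS, hSR⟩ := exists_search_problem LocalAlgorithm.polyBounded_witnessLen R hlen
    htotal ((A.polyBounded_verifyCost hd M).add (.const 1)) hLp
    fun n hn => hver n hn _ (hpub n)
  refine ⟨S, id, hS, isSampler_id, fun T => ?_⟩
  obtain ⟨K, hK⟩ := (A.polyBounded_shifts hd).mul
    ((PolyBounded.const 2).mul (A.polyBounded_groupSize hd))
  have habs : Negligible fun n => |ε n| := by
    have := (Asymptotics.superpolynomialDecay_iff_superpolynomialDecay_abs _ _ _).1 hε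
    simpa only [Negligible, Nat.abs_cast] using this
  -- `K` bounds the loss from shifts and samples. The absolute value allows for negative `ε n`, and
  -- the extra power of 1/2 makes the final inequality strict. The solver size `T` does not enter.
  let μ : ℕ → ℝ := fun n => ((K.eval n : ℕ) : ℝ) * |ε n| + (1 / 2) ^ n
  have hμ : Negligible μ := (habs.polynomial_mul K).add negligible_half_pow
  refine ⟨_, hμ.extend Lp hLp, fun Sol hSol => ?_⟩
  -- The size of the adversaries built from the solvers, as a function of the graph size; only here
  -- does `T` matter. The guarantee of `A` against size `Q` holds for all large n, so it meets
  -- infinitely many bad n.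
  obtain ⟨Q, hQ⟩ : PolyBounded fun n =>
      4 * (Lp.eval n + T.eval (Lp.eval n)) + 1 + LocalAlgorithm.decodeCost Ψ n := by
    have hT : PolyBounded fun n => T.eval (Lp.eval n) :=
      ⟨T.comp Lp, fun n => by rw [Polynomial.eval_comp]⟩
    exact (((PolyBounded.const 4).mul ((PolyBounded.eval Lp).add hT)).add (.const 1)).add
      LocalAlgorithm.polyBounded_decodeCost
  refine hLp.tendsto_atTop.frequently
    ((hbad.and_eventually (hA Q)).mono fun n ⟨hn, hAn⟩ => ?_)
  have hext := hLp.injective.extend_apply μ 0 n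
  rw [hext]
  have hwin := hhard n hn (Lp.eval n) (hpub n) (Sol (Lp.eval n)) (ε n) fun B hB =>
    hAn (N n hn) B (hB.trans (le_trans (by have := hSol (Lp.eval n); dsimp only; omega) (hQ n)))
  calc winProb S id (Lp.eval n) (Sol (Lp.eval n)) ≤ _ := prob_mono fun ω h =>
        (hSR n hn _ _ (List.length_ofFn)).1 (h (hS.total _))
    _ ≤ _ := hwin
    _ ≤ ((K.eval n : ℕ) : ℝ) * |ε n| := by
      refine (mul_le_mul_of_nonneg_left (le_abs_self _) (Nat.cast_nonneg _)).trans ?_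
      gcongr
      exact hK n
    _ < μ n := lt_add_of_pos_right _ (by positivity)
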